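/- Let $H:\mathbb R^2\to(0,1)$ be a Borel function that is homogeneous of degree zero, $H(\lambda\xi)=H(\xi)$ for all $\xi\in\mathbb R^2$ and $\lambda\in\mathbb R\setminus\{0\}$, with values in $[\underline H,\overline H]\subset(0,1)$, where $\underline H=\operatorname{ess\,inf}H$ and $\overline H=\operatorname{ess\,sup}H$; write $H(\theta)=H(\cos\theta,\sin\theta)$. Let $W$ be a complex Gaussian random measure on $\mathbb R^2$ with Lebesgue control measure, i.e. a centered, jointly Gaussian complex family $W(S)$ indexed by the Borel sets $S$ of finite Lebesgue measure, with $W(-S)=\overline{W(S)}$ a.s. and $\mathbb E[W(S)\overline{W(T)}]=\mathrm{Leb}(S\cap T)$. Let $A^{(H)}$ be the real anisotropic fractional Brownian motion $$A^{(H)}(u)=\int_{\mathbb R^2}\frac{e^{i\langle u,\xi\rangle}-1}{|\xi|^{H(\xi)+1}}\,dW(\xi),\qquad u\in\mathbb R^2 .$$ Fix $L\in(0,\infty)$, $\varepsilon\ge 0$, $\omega\in[0,2\pi)$, and put, for $t\in[0,1]$ and $n\ge 1$, $$Z_t=A^{(H)}\big(L(t+\varepsilon)\cos\omega,\;L(t+\varepsilon)\sin\omega\big),\qquad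 V_n(Z)=\sum_{k=1}^{n-1}\big[Z_{(k+1)/n}+Z_{(k-1)/n}-2Z_{k/n}\big]^2 .$$ Let $$C(1,h)=\Big(\frac{\pi}{h\,\Gamma(2h)\sin(h\pi)}\Big)^{1/2},\qquad \Lambda(\theta)=\frac{C(1,H(\theta))^2}{8}\,L^{2H(\theta)}\,|\cos(\theta-\omega)|^{2H(\theta)},\qquad J_{\underline H}=8\int_0^{\pi}\Lambda(\theta)\,\mathbf 1_{\{H(\theta)=\underline H\}}\,d\theta .$$ For $\gamma\in(0,2)$ and integers $l\ge 2$ let $$\rho_\gamma(l)=\int_l^{l+1}du\int_{u-1}^{u}dv\int_0^{1}dx\int_{x-1}^{x}\frac{dy}{(v-y)^{2+\gamma}},\qquad \|\rho_\gamma\|^2=\sum_{l=2}^{\infty}\rho_\gamma(l)^2,$$ and, for $h\in(0,1)$, $$\sigma^2_{\mathrm{FBM},h}=2(4-2^{2h})^2+(2^{2h+2}-7-3^{2h})^2+(2h)^2(2h-1)^2(2h-2)^2(2h-3)^2\,\|\rho_{2-2h}\|^2 .$$ Assume that $\mathrm{Leb}\{\theta\in[0,2\pi):H(\theta)=\underline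 H\}>0$ (the locally asymptotically self-similar case) and that $\mathrm{Leb}\{\theta\in[0,2\pi):\underline H<H(\theta)\le\underline H+1/4\}=0$. Then, as $n\to\infty$, $$\sqrt n\,\Big(n^{2\underline H-1}V_n(Z)-(4-2^{2\underline H})\,J_{\underline H}\Big)\xrightarrow{(\mathcal L)}\mathcal N\big(0,\;J_{\underline H}^2\,\sigma^2_{\mathrm{FBM},\underline H}\big).$$ -/

import Mathlib

open MeasureTheory ProbabilityTheory Filter Topology

noncomputable section

namespace AFBM

/-! ### The complex Gaussian random measure and its stochastic integral -/

/-- Borel subsets of `ℝ^d` with finite Lebesgue measure. -/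
abbrev FiniteBorel (d : ℕ) : Type :=
  {S : Set (EuclideanSpace ℝ (Fin d)) // MeasurableSet S ∧ volume S < ⊤}

/-- `W` is a complex (Hermitian) Gaussian random measure on `ℝ^d` with Lebesgue control measure:
a centered, jointly Gaussian family `W(S)` with `W(-S) = conj W(S)` and
`E[W(S) conj W(T)] = Leb(S ∩ T)`. It follows that `Re W` and `Im W` are independent, with
`E[Re W(S) Re W(T)] = (Leb(S ∩ T) + Leb(S ∩ -T)) / 2` and
`E[Im W(S) Im W(T)] = (Leb(S ∩ T) - Leb(S ∩ -T)) / 2`, and that `W` is countably additive in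
`L²(P)`. -/
structure IsComplexGaussianMeasure {Ω : Type*} [MeasurableSpace Ω] {d : ℕ}
    (W : FiniteBorel d → Ω → ℂ) (P : Measure Ω) : Prop where
  isGaussianProcess : IsGaussianProcess W P
  integral_eq_zero : ∀ S, ∫ ω, W S ω ∂P = 0
  covariance : ∀ S T : FiniteBorel d,
    ∫ ω, W S ω * (starRingEnd ℂ) (W T ω) ∂P = ((volume.real (S.1 ∩ T.1) : ℝ) : ℂ)
  hermitian : ∀ S T : FiniteBorel d, T.1 = (fun ξ ↦ -ξ) ⁻¹' S.1 →
    ∀ᵐ ω ∂P, W T ω = (starRingEnd ℂ) (W S ω)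

/-- The step function `∑ a_S 1_S`. -/
def stepFunction {d : ℕ} (c : FiniteBorel d →₀ ℂ) (ξ : EuclideanSpace ℝ (Fin d)) : ℂ :=
  c.sum fun S a ↦ S.1.indicator (fun _ ↦ a) ξ

/-- The elementary integral `∑ a_S W(S)` of the step function `∑ a_S 1_S`. -/
def stepIntegral {Ω : Type*} {d : ℕ} (W : FiniteBorel d → Ω → ℂ) (c : FiniteBorel d →₀ ℂ)
    (ω : Ω) : ℂ :=
  c.sum fun S a ↦ a * W S ω

/-- `X = ∫ f dW`: there are step functions converging to `f` in `L²(ℝ^d)` whose elementary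
integrals converge to `X` in `L²(P)`. (So `f` and `X` are square integrable, and by the isometry
property `X` is a.s. unique and does not depend on the step functions.) -/
def IsStochasticIntegral {Ω : Type*} [MeasurableSpace Ω] {d : ℕ} (W : FiniteBorel d → Ω → ℂ)
    (P : Measure Ω) (f : EuclideanSpace ℝ (Fin d) → ℂ) (X : Ω → ℂ) : Prop :=
  AEStronglyMeasurable f volume ∧ AEStronglyMeasurable X P ∧
    ∃ c : ℕ → (FiniteBorel d →₀ ℂ),
      Tendsto (fun m ↦ eLpNorm (fun ξ ↦ stepFunction (c m) ξ - f ξ) 2 volume) atTop (𝓝 0) ∧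
      Tendsto (fun m ↦ eLpNorm (fun ω ↦ stepIntegral W (c m) ω - X ω) 2 P) atTop (𝓝 0)

/-! ### Anisotropic fractional Brownian motion -/

/-- `ess inf H` with respect to Lebesgue measure. -/
def lowerIndex {d : ℕ} (H : EuclideanSpace ℝ (Fin d) → ℝ) : ℝ := essInf H volume

/-- `ess sup H` with respect to Lebesgue measure. -/
def upperIndex {d : ℕ} (H : EuclideanSpace ℝ (Fin d) → ℝ) : ℝ := essSup H volume

/-- A directional Hurst index on `ℝ^d`: a Borel function, homogeneous of degree zero, with values
in `[ess inf H, ess sup H] ⊆ (0, 1)`. -/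
structure IsDirectionalHurstIndex {d : ℕ} (H : EuclideanSpace ℝ (Fin d) → ℝ) : Prop where
  measurable : Measurable H
  homogeneous : ∀ (ξ : EuclideanSpace ℝ (Fin d)) (r : ℝ), r ≠ 0 → H (r • ξ) = H ξ
  mem_Icc : ∀ ξ, H ξ ∈ Set.Icc (lowerIndex H) (upperIndex H)
  lowerIndex_pos : 0 < lowerIndex H
  upperIndex_lt_one : upperIndex H < 1

/-- The harmonizable kernel `ξ ↦ (exp(i⟨u, ξ⟩) - 1) / |ξ|^(H(ξ) + d/2)`. -/
def kernel {d : ℕ} (H : EuclideanSpace ℝ (Fin d) → ℝ) (u ξ : EuclideanSpace ℝ (Fin d)) : ℂ :=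
  (Complex.exp (Complex.I * ((inner ℝ u ξ : ℝ) : ℂ)) - 1) /
    ((‖ξ‖ ^ (H ξ + (d : ℝ) / 2) : ℝ) : ℂ)

/-- `A` is the anisotropic fractional Brownian motion with directional Hurst index `H` driven by
`W`: for every `u`, `A(u) = ∫ (exp(i⟨u, ξ⟩) - 1) / |ξ|^(H(ξ) + d/2) dW(ξ)`. -/
def IsAFBM {Ω : Type*} [MeasurableSpace Ω] {d : ℕ} (H : EuclideanSpace ℝ (Fin d) → ℝ)
    (W : FiniteBorel d → Ω → ℂ) (P : Measure Ω) (A : EuclideanSpace ℝ (Fin d) → Ω → ℝ) : Prop :=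
  ∀ u, IsStochasticIntegral W P (kernel H u) (fun ω ↦ (A u ω : ℂ))

/-! ### Dimension two: restriction to a radial segment -/

/-- `H` as a function of the angle. -/
def angular (H : EuclideanSpace ℝ (Fin 2) → ℝ) (θ : ℝ) : ℝ := H !₂[Real.cos θ, Real.sin θ]

/-- `Z_t = A(L (t + ε) cos φ, L (t + ε) sin φ)`. -/
def restrictToSegment {Ω : Type*} (A : EuclideanSpace ℝ (Fin 2) → Ω → ℝ) (L ε φ : ℝ)
    (t : ℝ) (ω : Ω) : ℝ :=
  A !₂[L * (t + ε) * Real.cos φ, L * (t + ε) * Real.sin φ] ω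

/-- The second-order quadratic variation
`V_n(X) = ∑_{k=1}^{n-1} (X_{(k+1)/n} + X_{(k-1)/n} - 2 X_{k/n})²`. -/
def quadVar {Ω : Type*} (X : ℝ → Ω → ℝ) (n : ℕ) (ω : Ω) : ℝ :=
  ∑ k ∈ Finset.Ico 1 n,
    (X (((k : ℝ) + 1) / n) ω + X (((k : ℝ) - 1) / n) ω - 2 * X ((k : ℝ) / n) ω) ^ 2

/-! ### The constants -/

/-- `C(d, h) = (π^((d+1)/2) Γ(h+1/2) / (h Γ(2h) sin(hπ) Γ(h+d/2)))^(1/2)`. -/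
def constC (d : ℕ) (h : ℝ) : ℝ :=
  √(Real.pi ^ (((d : ℝ) + 1) / 2) * Real.Gamma (h + 1 / 2) /
    (h * Real.Gamma (2 * h) * Real.sin (h * Real.pi) * Real.Gamma (h + (d : ℝ) / 2)))

/-- `Λ(θ) = C(1, H(θ))² / 8 * L^(2H(θ)) * |cos(θ - φ)|^(2H(θ))`. -/
def Lam (H : EuclideanSpace ℝ (Fin 2) → ℝ) (L φ θ : ℝ) : ℝ :=
  constC 1 (angular H θ) ^ 2 / 8 * L ^ (2 * angular H θ) *
    |Real.cos (θ - φ)| ^ (2 * angular H θ)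

/-- `J = 8 ∫_0^π Λ(θ) 1_{H(θ) = ess inf H} dθ`. -/
def constJ (H : EuclideanSpace ℝ (Fin 2) → ℝ) (L φ : ℝ) : ℝ :=
  8 * ∫ θ in (0 : ℝ)..Real.pi, {θ | angular H θ = lowerIndex H}.indicator (Lam H L φ) θ

/-- `ρ_γ(j, k) = ∫_j^{j+1} du ∫_{u-1}^u dv ∫_k^{k+1} dx ∫_{x-1}^x dy / (v - y)^(2+γ)`. -/
def rho (γ j k : ℝ) : ℝ :=
  ∫ u in j..(j + 1), ∫ v in (u - 1)..u, ∫ x in k..(k + 1), ∫ y in (x - 1)..x,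
    1 / (v - y) ^ (2 + γ)

/-- `‖ρ_γ‖² = ∑_{l ≥ 2} ρ_γ(l)²`, where `ρ_γ(l) = ρ_γ(l, 0)`. -/
def rhoNormSq (γ : ℝ) : ℝ := ∑' l : ℕ, rho γ ((l : ℝ) + 2) 0 ^ 2

/-- The asymptotic variance of the normalized second-order quadratic variation of fractional
Brownian motion with Hurst index `h`. -/
def sigmaSqFBM (h : ℝ) : ℝ :=
  2 * (4 - 2 ^ (2 * h)) ^ 2 + (2 ^ (2 * h + 2) - 7 - 3 ^ (2 * h)) ^ 2 +
    (2 * h) ^ 2 * (2 * h - 1) ^ 2 * (2 * h - 2) ^ 2 * (2 * h - 3) ^ 2 * rhoNormSq (2 - 2 * h)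

end AFBM

end

namespace AFBM

open Set ComplexConjugate

/-! A second-order increment of `Z` is the integral against `W` of a kernel which is a phase times a
real function. The position `k / n` and the offset `ε` enter the phase only, so the increments are
stationary: their covariance matrix is Toeplitz. In polar coordinates the radial integral is
explicit (`integral_cos_mul_one_sub_cos_sq`), and the direction `θ` contributes the covariance
`fbmCov` of second differences of a fractional Brownian motion with index `H(θ)`. The covariance at
lag `m` is thus the angular mixture `∫ 4 Λ(θ) n^(-2H(θ)) fbmCov (H(θ)) m dθ`.

Multiply by `n^(2h)` with `h = ess inf H`. Directions with `H(θ) > h` carry a factor tending to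
zero, so by dominated convergence the covariance tends to `J * fbmCov h m` (`tendsto_normCov`),
under a bound `C / (m+1)²` uniform in `n`. Differencing twice makes this decay available for every
index in `(0, 1)`.

The quadratic variation is the squared norm of a Gaussian vector. Diagonalizing its covariance
matrix turns the characteristic function into a product of factors `(1 - 2isλ)^(-1/2)` over the
eigenvalues (`integral_exp_sum_sq`). Expand the logarithm in the normalized eigenvalues: the linear
term is the trace, that is the mean; the quadratic term is the squared Frobenius norm, a Toeplitz
sum converging to half the variance; the cubic remainder is at most a constant times the largest
eigenvalue times the quadratic term. Gershgorin's theorem and the summable covariance make the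
largest eigenvalue `O(n^(-1/2))`, so only the Gaussian part survives.

Two points remain. The mean must match the centering constant to within `o(n^(-1/2))`; the gap `1/4`
above `h` gives this, since the other directions contribute `√n * n^(-2(H(θ)-h))`
(`tendsto_sqrt_mul_normCov_sub`). And the limiting sum of squared covariances must be the stated
constant; integrating `rho` four times yields the fourth difference of `t^(2h)` (`mul_rho`,
`sigmaSqFBM_eq`). -/

/-! ### The integral `∫ (1 - cos(as)) s^(-2h-1) ds` -/

/-- Tonelli's theorem on the positive quadrant. -/
theorem integral_Ioi_swap_of_nonneg {f : ℝ → ℝ → ℝ} {A B : ℝ → ℝ}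
    (hf : Measurable (Function.uncurry f)) (hpos : ∀ x > 0, ∀ y > 0, 0 ≤ f x y)
    (hA : ∀ x > 0, ∫ y in Ioi 0, f x y = A x)
    (hBi : ∀ y > 0, IntegrableOn (fun x ↦ f x y) (Ioi 0))
    (hB : ∀ y > 0, ∫ x in Ioi 0, f x y = B y) (hBint : IntegrableOn B (Ioi 0)) :
    IntegrableOn A (Ioi 0) ∧ ∫ x in Ioi 0, A x = ∫ y in Ioi 0, B y := by
  have hint : Integrable (Function.uncurry f)
      ((volume.restrict (Ioi (0 : ℝ))).prod (volume.restrict (Ioi (0 : ℝ)))) := by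
    rw [integrable_prod_iff' hf.aestronglyMeasurable]
    refine ⟨(ae_restrict_iff' measurableSet_Ioi).2 (.of_forall fun y hy ↦ hBi y hy), ?_⟩
    refine hBint.congr_fun (fun y hy ↦ ?_) measurableSet_Ioi
    rw [← hB y hy]
    refine setIntegral_congr_fun measurableSet_Ioi fun x hx ↦ ?_
    simp [abs_of_nonneg (hpos x hx y hy)]
  have hswap := integral_integral_swap hint
  have hA' : ∀ x ∈ Ioi (0 : ℝ), ∫ y in Ioi 0, f x y = A x := fun x hx ↦ hA x hx
  have hB' : ∀ y ∈ Ioi (0 : ℝ), ∫ x in Ioi 0, f x y = B y := fun x hx ↦ hB x hx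
  rw [setIntegral_congr_fun measurableSet_Ioi hA', setIntegral_congr_fun measurableSet_Ioi hB']
    at hswap
  exact ⟨IntegrableOn.congr_fun hint.integral_prod_left hA' measurableSet_Ioi, hswap⟩

/-- Writing `1/(1+y)` as `∫ exp(-t(1+y)) dt` and exchanging integrals gives `Γ(a) Γ(1-a)`; Euler's
reflection formula finishes. -/
theorem integral_rpow_div_one_add {a : ℝ} (ha : a ∈ Ioo (0 : ℝ) 1) :
    IntegrableOn (fun y : ℝ ↦ y ^ (a - 1) / (1 + y)) (Ioi 0) ∧
      ∫ y in Ioi (0 : ℝ), y ^ (a - 1) / (1 + y) = Real.pi / Real.sin (Real.pi * a) := by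
  have key := integral_Ioi_swap_of_nonneg (f := fun y t : ℝ ↦ y ^ (a - 1) * Real.exp (-(t * (1 + y))))
    (A := fun y ↦ y ^ (a - 1) / (1 + y)) (B := fun t ↦ Real.Gamma a * (Real.exp (-t) * t ^ (1 - a - 1)))
    (by fun_prop) (fun x hx y hy ↦ by positivity) (fun y hy ↦ ?_) (fun t ht ↦ ?_) (fun t ht ↦ ?_)
    ((Real.GammaIntegral_convergent (by linarith [ha.2])).const_mul _)
  · rw [integral_const_mul, ← Real.Gamma_eq_integral (by linarith [ha.2]),
      Real.Gamma_mul_Gamma_one_sub] at key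
    exact key
  · rw [integral_const_mul, div_eq_mul_inv]
    congr 1
    have := integral_exp_mul_Ioi (a := -(1 + y)) (by linarith) 0
    simp only [mul_zero, Real.exp_zero, neg_div_neg_eq, one_div] at this
    rw [← this]
    exact integral_congr_ae (.of_forall fun t ↦ by ring_nf)
  · have h := Real.integral_rpow_mul_exp_neg_mul_Ioi ha.1 ht
    -- A non-integrable function has Bochner integral zero, so the nonzero value of the Gamma
    -- integral already proves integrability.
    have h2 : IntegrableOn (fun y : ℝ ↦ y ^ (a - 1) * Real.exp (-(t * y))) (Ioi 0) :=
      .of_integral_ne_zero (by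
        rw [h]
        have := Real.Gamma_pos_of_pos ha.1
        positivity)
    refine (h2.const_mul (Real.exp (-t))).congr (.of_forall fun y ↦ ?_)
    simp only [mul_add, mul_one, neg_add, Real.exp_add]
    ring
  · have h := Real.integral_rpow_mul_exp_neg_mul_Ioi ha.1 ht
    have h2 : ∀ y : ℝ, y ^ (a - 1) * Real.exp (-(t * (1 + y))) =
        Real.exp (-t) * (y ^ (a - 1) * Real.exp (-(t * y))) := fun y ↦ by
      simp only [mul_add, mul_one, neg_add, Real.exp_add]
      ring
    simp_rw [h2]
    rw [integral_const_mul, h, one_div, Real.inv_rpow ht.le, ← Real.rpow_neg ht.le]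
    ring_nf

theorem integral_rpow_div_one_add_sq {h : ℝ} (hh : h ∈ Ioo (0 : ℝ) 1) :
    IntegrableOn (fun x : ℝ ↦ x ^ (2 * h - 1) / (1 + x ^ 2)) (Ioi 0) ∧
      ∫ x in Ioi (0 : ℝ), x ^ (2 * h - 1) / (1 + x ^ 2) =
        Real.pi / Real.sin (Real.pi * h) / 2 := by
  obtain ⟨h1, h2⟩ := integral_rpow_div_one_add hh
  have hcongr : ∀ x ∈ Ioi (0 : ℝ), x ^ ((2 : ℝ) - 1) • ((x ^ (2 : ℝ)) ^ (h - 1) / (1 + x ^ (2 : ℝ))) =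
      x ^ (2 * h - 1) / (1 + x ^ 2) := fun x hx ↦ by
    rw [← Real.rpow_mul (le_of_lt hx), smul_eq_mul, ← mul_div_assoc, ← Real.rpow_add hx,
      Real.rpow_two]
    ring_nf
  constructor
  · exact ((integrableOn_Ioi_comp_rpow_iff' _ two_ne_zero).2 h1).congr_fun hcongr measurableSet_Ioi
  · rw [← integral_comp_rpow_Ioi_of_pos two_pos] at h2
    simp_rw [mul_smul] at h2
    rw [integral_smul, setIntegral_congr_fun measurableSet_Ioi hcongr, smul_eq_mul] at h2
    linarith

/-- The explicit antiderivative `g` vanishes at infinity; since the integrand is nonnegative, this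
yields integrability as well as the value. -/
theorem integral_one_sub_cos_mul_exp {x : ℝ} (hx : 0 < x) :
    IntegrableOn (fun s : ℝ ↦ (1 - Real.cos s) * Real.exp (-(x * s))) (Ioi 0) ∧
      ∫ s in Ioi (0 : ℝ), (1 - Real.cos s) * Real.exp (-(x * s)) = 1 / (x * (1 + x ^ 2)) := by
  let g : ℝ → ℝ := fun s ↦ Real.exp (-(x * s)) *
    (-1 / x + (x * Real.cos s - Real.sin s) / (1 + x ^ 2))
  have hd : ∀ s ∈ Ici (0 : ℝ),
      HasDerivAt g ((1 - Real.cos s) * Real.exp (-(x * s))) s := fun s _ ↦ by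
    have h1 : HasDerivAt (fun s : ℝ ↦ Real.exp (-(x * s))) (Real.exp (-(x * s)) * (-(x * 1))) s :=
      ((hasDerivAt_id s).const_mul x).neg.exp
    have h2 : HasDerivAt (fun s : ℝ ↦ -1 / x + (x * Real.cos s - Real.sin s) / (1 + x ^ 2))
        ((x * -Real.sin s - Real.cos s) / (1 + x ^ 2)) s :=
      ((((Real.hasDerivAt_cos s).const_mul x).sub (Real.hasDerivAt_sin s)).div_const _).const_add _
    convert! h1.mul h2 using 1
    field_simp
    ring
  have hp : ∀ s ∈ Ioi (0 : ℝ), 0 ≤ (1 - Real.cos s) * Real.exp (-(x * s)) := fun s _ ↦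
    mul_nonneg (by linarith [Real.cos_le_one s]) (Real.exp_nonneg _)
  have hl : Tendsto g atTop (𝓝 0) := by
    have h1 : Tendsto (fun s : ℝ ↦ Real.exp (-(x * s))) atTop (𝓝 0) :=
      Real.tendsto_exp_neg_atTop_nhds_zero.comp (tendsto_id.const_mul_atTop hx)
    refine h1.zero_mul_isBoundedUnder_le ?_
    refine isBoundedUnder_of ⟨1 / x + (x + 1) / (1 + x ^ 2), fun s ↦ ?_⟩
    simp only [Function.comp, Real.norm_eq_abs]
    refine (abs_add_le _ _).trans (add_le_add ?_ ?_)
    · rw [abs_div, abs_neg, abs_one, abs_of_pos hx]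
    · rw [abs_div, abs_of_pos (by positivity : 0 < 1 + x ^ 2)]
      gcongr
      refine (abs_sub _ _).trans (add_le_add ?_ (Real.abs_sin_le_one s))
      rw [abs_mul, abs_of_pos hx]
      exact mul_le_of_le_one_right hx.le (Real.abs_cos_le_one s)
  refine ⟨integrableOn_Ioi_deriv_of_nonneg' hd hp hl, ?_⟩
  rw [integral_Ioi_of_hasDerivAt_of_nonneg' hd hp hl]
  simp only [g, mul_zero, neg_zero, Real.exp_zero, Real.cos_zero, Real.sin_zero]
  field_simp
  ring

theorem constC_one_sq {h : ℝ} (hh : h ∈ Ioo (0 : ℝ) 1) :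
    constC 1 h ^ 2 = Real.pi / (h * Real.Gamma (2 * h) * Real.sin (h * Real.pi)) := by
  have h1 : 0 < Real.Gamma (2 * h) := Real.Gamma_pos_of_pos (by linarith [hh.1])
  have h2 : 0 < Real.Gamma (h + 1 / 2) := Real.Gamma_pos_of_pos (by linarith [hh.1])
  have h3 : 0 < Real.sin (h * Real.pi) :=
    Real.sin_pos_of_pos_of_lt_pi (mul_pos hh.1 Real.pi_pos)
      (by nlinarith [hh.2, Real.pi_pos])
  have h4 := hh.1
  have e : Real.pi ^ ((((1 : ℕ) : ℝ) + 1) / 2) = Real.pi := by norm_num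
  rw [constC, e, Nat.cast_one, Real.sq_sqrt (by positivity)]
  field_simp

/-- Represent `Γ(2h+1) s^(-(2h+1))` as `∫ x^(2h) exp(-xs) dx` and exchange integrals: the inner
integral becomes the Laplace transform of `1 - cos`, leaving `∫ x^(2h-1)/(1+x²) dx`. -/
theorem integral_one_sub_cos_mul_rpow {h : ℝ} (hh : h ∈ Ioo (0 : ℝ) 1) :
    IntegrableOn (fun s : ℝ ↦ (1 - Real.cos s) * s ^ (-(2 * h + 1))) (Ioi 0) ∧
      ∫ s in Ioi (0 : ℝ), (1 - Real.cos s) * s ^ (-(2 * h + 1)) = constC 1 h ^ 2 / 4 := by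
  have hG : 0 < Real.Gamma (2 * h + 1) := Real.Gamma_pos_of_pos (by linarith [hh.1])
  obtain ⟨i1, i2⟩ := integral_rpow_div_one_add_sq hh
  have key := integral_Ioi_swap_of_nonneg
    (f := fun s x : ℝ ↦ x ^ (2 * h) * ((1 - Real.cos s) * Real.exp (-(x * s))))
    (A := fun s ↦ Real.Gamma (2 * h + 1) * ((1 - Real.cos s) * s ^ (-(2 * h + 1))))
    (B := fun x ↦ x ^ (2 * h - 1) / (1 + x ^ 2))
    (by fun_prop) (fun s hs x hx ↦ ?_) (fun s hs ↦ ?_) (fun x hx ↦ ?_) (fun x hx ↦ ?_) i1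
  · obtain ⟨k1, k2⟩ := key
    rw [i2, integral_const_mul] at k2
    constructor
    · refine (k1.const_mul (Real.Gamma (2 * h + 1))⁻¹).congr (.of_forall fun s ↦ ?_)
      simp only
      field_simp
    · rw [← mul_right_inj' hG.ne', k2, constC_one_sq hh, Real.Gamma_add_one (by linarith [hh.1]),
        mul_comm h Real.pi]
      have h1 : 0 < Real.Gamma (2 * h) := Real.Gamma_pos_of_pos (by linarith [hh.1])
      have h3 : 0 < Real.sin (Real.pi * h) :=
        Real.sin_pos_of_pos_of_lt_pi (mul_pos Real.pi_pos hh.1)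
          (by nlinarith [hh.2, Real.pi_pos])
      have h4 := hh.1
      field_simp
      ring
  · exact mul_nonneg (Real.rpow_nonneg hx.le _)
      (mul_nonneg (by linarith [Real.cos_le_one s]) (Real.exp_nonneg _))
  · have e : ∀ x : ℝ, x ^ (2 * h) * ((1 - Real.cos s) * Real.exp (-(x * s))) =
        (1 - Real.cos s) * (x ^ (2 * h + 1 - 1) * Real.exp (-(s * x))) := fun x ↦ by
      rw [add_sub_cancel_right, mul_comm s x]
      ring
    simp_rw [e]
    rw [integral_const_mul, Real.integral_rpow_mul_exp_neg_mul_Ioi (by linarith [hh.1]) hs,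
      one_div, Real.inv_rpow hs.le, ← Real.rpow_neg hs.le]
    ring
  · exact (integral_one_sub_cos_mul_exp hx).1.const_mul _
  · rw [integral_const_mul, (integral_one_sub_cos_mul_exp hx).2, Real.rpow_sub_one hx.ne']
    field_simp

theorem integral_one_sub_cos_mul_rpow_scaled {h : ℝ} (hh : h ∈ Ioo (0 : ℝ) 1) (a : ℝ) :
    IntegrableOn (fun s : ℝ ↦ (1 - Real.cos (a * s)) * s ^ (-(2 * h + 1))) (Ioi 0) ∧
      ∫ s in Ioi (0 : ℝ), (1 - Real.cos (a * s)) * s ^ (-(2 * h + 1)) =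
        |a| ^ (2 * h) * (constC 1 h ^ 2 / 4) := by
  wlog ha : 0 ≤ a generalizing a
  · have := this (-a) (by linarith)
    simpa [Real.cos_neg] using this
  rcases ha.eq_or_lt with rfl | ha
  · have := hh.1
    simp [Real.zero_rpow (by linarith : 2 * h ≠ 0), IntegrableOn]
  obtain ⟨i1, i2⟩ := integral_one_sub_cos_mul_rpow hh
  have e : ∀ s ∈ Ioi (0 : ℝ), a ^ (2 * h + 1) * ((1 - Real.cos (a * s)) * (a * s) ^ (-(2 * h + 1))) =
      (1 - Real.cos (a * s)) * s ^ (-(2 * h + 1)) := fun s hs ↦ by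
    rw [Real.mul_rpow ha.le (le_of_lt hs), Real.rpow_neg ha.le]
    have := Real.rpow_pos_of_pos ha (2 * h + 1)
    field_simp
  constructor
  · refine IntegrableOn.congr_fun (Integrable.const_mul ?_ (a ^ (2 * h + 1))) e measurableSet_Ioi
    exact (integrableOn_Ioi_comp_mul_left_iff
      (fun s : ℝ ↦ (1 - Real.cos s) * s ^ (-(2 * h + 1))) 0 ha).2 (by simpa using i1)
  · rw [← setIntegral_congr_fun measurableSet_Ioi e, integral_const_mul,
      integral_comp_mul_left_Ioi (fun s : ℝ ↦ (1 - Real.cos s) * s ^ (-(2 * h + 1))) 0 ha,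
      mul_zero, i2, abs_of_pos ha, Real.rpow_add_one ha.ne', smul_eq_mul]
    field_simp

/-! ### Second differences -/

/-- The covariance at lag `x` of the second-order increments of a standard fractional Brownian
motion with Hurst index `h`. -/
noncomputable def fbmCov (h x : ℝ) : ℝ :=
  -(|x + 2| ^ (2 * h) - 4 * |x + 1| ^ (2 * h) + 6 * |x| ^ (2 * h) - 4 * |x - 1| ^ (2 * h) +
    |x - 2| ^ (2 * h)) / 2

/-- Multiplying by `4(1 - cos t)² = |e^(it) + e^(-it) - 2|²` takes a fourth central difference in
`x`. The coefficients 1, -4, 6, -4, 1 sum to zero, so each cosine may be replaced by `-(1 - cos)`,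
which is integrable against `s^(-(2h+1))`. -/
theorem cos_mul_one_sub_cos_sq (x t : ℝ) :
    Real.cos (x * t) * (4 * (1 - Real.cos t) ^ 2) =
      -((1 - Real.cos ((x + 2) * t)) - 4 * (1 - Real.cos ((x + 1) * t)) +
        6 * (1 - Real.cos (x * t)) - 4 * (1 - Real.cos ((x - 1) * t)) +
        (1 - Real.cos ((x - 2) * t))) := by
  have e : ∀ j : ℝ, (x + j) * t = x * t + j * t := fun j ↦ by ring
  have e' : ∀ j : ℝ, (x - j) * t = x * t - j * t := fun j ↦ by ring
  rw [e, e, e', e', Real.cos_add, Real.cos_add, Real.cos_sub, Real.cos_sub, Real.cos_two_mul,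
    Real.sin_two_mul, one_mul]
  ring

theorem integral_fourth_difference {α : Type*} [MeasurableSpace α] {μ : Measure α}
    {f₁ f₂ f₃ f₄ f₅ : α → ℝ} (h₁ : Integrable f₁ μ) (h₂ : Integrable f₂ μ) (h₃ : Integrable f₃ μ)
    (h₄ : Integrable f₄ μ) (h₅ : Integrable f₅ μ) :
    ∫ x, f₁ x - 4 * f₂ x + 6 * f₃ x - 4 * f₄ x + f₅ x ∂μ =
      ∫ x, f₁ x ∂μ - 4 * ∫ x, f₂ x ∂μ + 6 * ∫ x, f₃ x ∂μ - 4 * ∫ x, f₄ x ∂μ + ∫ x, f₅ x ∂μ := by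
  have i₁ : Integrable (fun x ↦ f₁ x - 4 * f₂ x) μ := h₁.sub (h₂.const_mul 4)
  have i₂ : Integrable (fun x ↦ f₁ x - 4 * f₂ x + 6 * f₃ x) μ := i₁.add (h₃.const_mul 6)
  have i₃ : Integrable (fun x ↦ f₁ x - 4 * f₂ x + 6 * f₃ x - 4 * f₄ x) μ :=
    i₂.sub (h₄.const_mul 4)
  rw [integral_add i₃ h₅, integral_sub i₂ (h₄.const_mul 4), integral_add i₁ (h₃.const_mul 6),
    integral_sub h₁ (h₂.const_mul 4)]
  simp only [integral_const_mul]

theorem integral_cos_mul_one_sub_cos_sq {h : ℝ} (hh : h ∈ Ioo (0 : ℝ) 1) (x a : ℝ) :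
    ∫ s in Ioi (0 : ℝ), Real.cos (x * (a * s)) * (4 * (1 - Real.cos (a * s)) ^ 2) *
        s ^ (-(2 * h + 1)) =
      constC 1 h ^ 2 / 2 * |a| ^ (2 * h) * fbmCov h x := by
  have I := fun j : ℝ ↦ (integral_one_sub_cos_mul_rpow_scaled hh (j * a)).1
  have V := fun j : ℝ ↦ (integral_one_sub_cos_mul_rpow_scaled hh (j * a)).2
  have e : ∀ s : ℝ, Real.cos (x * (a * s)) * (4 * (1 - Real.cos (a * s)) ^ 2) * s ^ (-(2 * h + 1)) =
      -((1 - Real.cos ((x + 2) * a * s)) * s ^ (-(2 * h + 1)) -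
        4 * ((1 - Real.cos ((x + 1) * a * s)) * s ^ (-(2 * h + 1))) +
        6 * ((1 - Real.cos (x * a * s)) * s ^ (-(2 * h + 1))) -
        4 * ((1 - Real.cos ((x - 1) * a * s)) * s ^ (-(2 * h + 1))) +
        (1 - Real.cos ((x - 2) * a * s)) * s ^ (-(2 * h + 1))) := fun s ↦ by
    rw [cos_mul_one_sub_cos_sq]
    simp only [mul_assoc]
    ring
  simp_rw [e]
  rw [integral_neg, integral_fourth_difference (I _) (I _) (I _) (I _) (I _)]
  simp only [V, abs_mul, Real.mul_rpow (abs_nonneg _) (abs_nonneg _), fbmCov]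
  ring

/-! ### The covariance at large lags -/

/-- The second alternative allows a singularity at the left endpoint; it is needed for `rho` at `l =
2`, where `u - 2` reaches zero. -/
theorem intervalIntegrable_add_rpow {a b c q : ℝ} (hab : a ≤ b)
    (h : 0 < a + c ∨ 0 ≤ a + c ∧ 0 < q) :
    IntervalIntegrable (fun t : ℝ ↦ (t + c) ^ (q - 1)) volume a b := by
  have : IntervalIntegrable (fun t : ℝ ↦ t ^ (q - 1)) volume (a + c) (b + c) := by
    rcases h with h | h
    · refine intervalIntegral.intervalIntegrable_rpow (.inr ?_)
      rw [uIcc_of_le (by linarith)]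
      exact fun h' ↦ absurd h'.1 (by linarith)
    · exact intervalIntegral.intervalIntegrable_rpow' (by linarith)
  simpa using this.comp_add_right c

/-- Keeping the factor `q` on the left avoids dividing by it, so that `q = 0` is covered; this
occurs for `2h - 1` at `h = 1/2`. -/
theorem mul_integral_add_rpow {a b c q : ℝ} (hab : a ≤ b)
    (h : 0 < a + c ∨ 0 ≤ a + c ∧ 0 < q) :
    q * ∫ t in a..b, (t + c) ^ (q - 1) = (b + c) ^ q - (a + c) ^ q := by
  rw [intervalIntegral.integral_comp_add_right (fun t : ℝ ↦ t ^ (q - 1))]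
  rcases eq_or_ne q 0 with rfl | hq
  · simp
  rw [integral_rpow, sub_add_cancel, mul_div_cancel₀ _ hq]
  rcases h with h | h
  · refine .inr ⟨fun h ↦ hq (by linarith), ?_⟩
    rw [uIcc_of_le (by linarith)]
    exact fun h' ↦ absurd h'.1 (by linarith)
  · exact .inl (by linarith)

theorem mul_integral_sub_rpow {a b d q : ℝ} (hab : a ≤ b) (h : 0 < d - b) :
    q * ∫ t in a..b, (d - t) ^ (q - 1) = (d - a) ^ q - (d - b) ^ q := by
  rw [intervalIntegral.integral_comp_sub_left (fun t : ℝ ↦ t ^ (q - 1))]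
  simpa using mul_integral_add_rpow (a := d - b) (b := d - a) (c := 0) (q := q) (by linarith)
    (.inl (by simpa using h))

theorem mul_integral_rho₁ {h v x : ℝ} (hvx : x < v) :
    (2 * h - 3) * ∫ y in (x - 1)..x, 1 / (v - y) ^ (2 + (2 - 2 * h)) =
      (v - x + 1) ^ (2 * h - 3) - (v - x) ^ (2 * h - 3) := by
  have : ∫ y in (x - 1)..x, 1 / (v - y) ^ (2 + (2 - 2 * h)) =
      ∫ y in (x - 1)..x, (v - y) ^ (2 * h - 3 - 1) := by
    refine intervalIntegral.integral_congr fun y hy ↦ ?_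
    rw [uIcc_of_le (by linarith)] at hy
    rw [one_div, ← Real.rpow_neg (by linarith [hy.2])]
    ring_nf
  rw [this, mul_integral_sub_rpow (by linarith) (by linarith)]
  ring_nf

theorem mul_integral_rho₂ {h v : ℝ} (hv : 1 < v) :
    (2 * h - 2) * ((2 * h - 3) *
        ∫ x in (0 : ℝ)..(0 + 1), ∫ y in (x - 1)..x, 1 / (v - y) ^ (2 + (2 - 2 * h))) =
      (v + 1) ^ (2 * h - 2) - 2 * v ^ (2 * h - 2) + (v + -1) ^ (2 * h - 2) := by
  rw [← intervalIntegral.integral_const_mul]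
  have : ∫ x in (0 : ℝ)..(0 + 1), (2 * h - 3) *
        ∫ y in (x - 1)..x, 1 / (v - y) ^ (2 + (2 - 2 * h)) =
      ∫ x in (0 : ℝ)..1, ((v + 1 - x) ^ (2 * h - 2 - 1) - (v - x) ^ (2 * h - 2 - 1)) := by
    rw [zero_add]
    refine intervalIntegral.integral_congr fun x hx ↦ ?_
    rw [uIcc_of_le (by linarith)] at hx
    rw [mul_integral_rho₁ (by linarith [hx.2])]
    ring_nf
  rw [this, intervalIntegral.integral_sub, mul_sub, mul_integral_sub_rpow (by linarith) (by linarith),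
    mul_integral_sub_rpow (by linarith) (by linarith)]
  · ring_nf
  all_goals
    refine ContinuousOn.intervalIntegrable fun x hx ↦ ?_
    rw [uIcc_of_le (by linarith)] at hx
    refine (ContinuousAt.rpow_const (by fun_prop) (.inl ?_)).continuousWithinAt
    linarith [hx.2]

theorem mul_integral_rho₃ {h u : ℝ} (hu : 2 < u) :
    (2 * h - 1) * ((2 * h - 2) * ((2 * h - 3) * ∫ v in (u - 1)..u,
        ∫ x in (0 : ℝ)..(0 + 1), ∫ y in (x - 1)..x, 1 / (v - y) ^ (2 + (2 - 2 * h)))) =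
      (u + 1) ^ (2 * h - 1) - 3 * (u + 0) ^ (2 * h - 1) + 3 * (u + -1) ^ (2 * h - 1) -
        (u + -2) ^ (2 * h - 1) := by
  rw [← intervalIntegral.integral_const_mul, ← intervalIntegral.integral_const_mul]
  have : ∫ v in (u - 1)..u, (2 * h - 2) * ((2 * h - 3) *
        ∫ x in (0 : ℝ)..(0 + 1), ∫ y in (x - 1)..x, 1 / (v - y) ^ (2 + (2 - 2 * h))) =
      ∫ v in (u - 1)..u, ((v + 1) ^ (2 * h - 1 - 1) - 2 * (v + 0) ^ (2 * h - 1 - 1) +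
        (v + -1) ^ (2 * h - 1 - 1)) := by
    refine intervalIntegral.integral_congr fun v hv ↦ ?_
    rw [uIcc_of_le (by linarith)] at hv
    rw [mul_integral_rho₂ (by linarith [hv.1])]
    ring_nf
  have I : ∀ c : ℝ, -1 ≤ c → IntervalIntegrable (fun t : ℝ ↦ (t + c) ^ (2 * h - 1 - 1)) volume
      (u - 1) u := fun c hc ↦ intervalIntegrable_add_rpow (by linarith) (.inl (by linarith))
  have V : ∀ c : ℝ, -1 ≤ c → (2 * h - 1) * ∫ t in (u - 1)..u, (t + c) ^ (2 * h - 1 - 1) =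
      (u + c) ^ (2 * h - 1) - (u - 1 + c) ^ (2 * h - 1) := fun c hc ↦
    mul_integral_add_rpow (by linarith) (.inl (by linarith))
  rw [this, intervalIntegral.integral_add
      ((I 1 (by norm_num)).sub ((I 0 (by norm_num)).const_mul 2)) (I _ le_rfl),
    intervalIntegral.integral_sub (I 1 (by norm_num)) ((I 0 (by norm_num)).const_mul 2),
    intervalIntegral.integral_const_mul, mul_add, mul_sub, mul_left_comm _ (2 : ℝ),
    V 1 (by norm_num), V 0 (by norm_num), V (-1) le_rfl]
  ring_nf

/-- Each of the four integrations over a unit interval raises the exponent by one and takes a first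
difference. The numerical factors are exactly those produced by differentiating `t^(2h)` four times,
and the outcome is its fourth central difference at `l`. -/
theorem mul_rho {h l : ℝ} (hh : 0 < h) (hl : 2 ≤ l) :
    2 * h * (2 * h - 1) * (2 * h - 2) * (2 * h - 3) * rho (2 - 2 * h) l 0 = -2 * fbmCov h l := by
  rw [rho, mul_assoc, mul_assoc, mul_assoc, ← intervalIntegral.integral_const_mul,
    ← intervalIntegral.integral_const_mul, ← intervalIntegral.integral_const_mul]
  have : ∫ u in l..(l + 1), (2 * h - 1) * ((2 * h - 2) * ((2 * h - 3) * ∫ v in (u - 1)..u,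
        ∫ x in (0 : ℝ)..(0 + 1), ∫ y in (x - 1)..x, 1 / (v - y) ^ (2 + (2 - 2 * h)))) =
      ∫ u in l..(l + 1), ((u + 1) ^ (2 * h - 1) - 3 * (u + 0) ^ (2 * h - 1) +
        3 * (u + -1) ^ (2 * h - 1) - (u + -2) ^ (2 * h - 1)) := by
    -- At `l = 2` the endpoint `u = 2` violates the strict inequality of `mul_integral_rho₃`; the
    -- half-open interval excludes it.
    refine intervalIntegral.integral_congr_ae (.of_forall fun u hu ↦ ?_)
    rw [uIoc_of_le (by linarith)] at hu
    rw [mul_integral_rho₃ (by linarith [hu.1])]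
  have I : ∀ c : ℝ, -2 ≤ c → IntervalIntegrable (fun t : ℝ ↦ (t + c) ^ (2 * h - 1)) volume
      l (l + 1) := fun c hc ↦
    intervalIntegrable_add_rpow (by linarith) (.inr ⟨by linarith, by linarith⟩)
  have V : ∀ c : ℝ, -2 ≤ c → 2 * h * ∫ t in l..(l + 1), (t + c) ^ (2 * h - 1) =
      (l + 1 + c) ^ (2 * h) - (l + c) ^ (2 * h) := fun c hc ↦
    mul_integral_add_rpow (by linarith) (.inr ⟨by linarith, by linarith⟩)
  have I₂ := (I 1 (by norm_num)).sub ((I 0 (by norm_num)).const_mul 3)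
  have I₃ := I₂.add ((I (-1) (by norm_num)).const_mul 3)
  rw [this, intervalIntegral.integral_sub I₃ (I _ le_rfl),
    intervalIntegral.integral_add I₂ ((I (-1) (by norm_num)).const_mul 3),
    intervalIntegral.integral_sub (I 1 (by norm_num)) ((I 0 (by norm_num)).const_mul 3),
    intervalIntegral.integral_const_mul, intervalIntegral.integral_const_mul, mul_sub, mul_add,
    mul_sub, mul_left_comm _ (3 : ℝ), mul_left_comm _ (3 : ℝ), V 1 (by norm_num),
    V 0 (by norm_num), V (-1) (by norm_num), V (-2) le_rfl, fbmCov, abs_of_nonneg (by linarith),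
    abs_of_nonneg (by linarith), abs_of_nonneg (by linarith), abs_of_nonneg (by linarith),
    abs_of_nonneg (by linarith)]
  ring_nf

/-- The iterated domain consists of unit intervals, and on it `v - y ≥ l - 2`. -/
theorem abs_rho_le {γ l : ℝ} (hγ : 0 < γ) (hl : 3 ≤ l) : |rho γ l 0| ≤ (l - 2) ^ (-(2 + γ)) := by
  have hb : ∀ u ∈ uIoc l (l + 1), ∀ v ∈ uIoc (u - 1) u, ∀ x ∈ uIoc (0 : ℝ) (0 + 1),
      ∀ y ∈ uIoc (x - 1) x, ‖1 / (v - y) ^ (2 + γ)‖ ≤ (l - 2) ^ (-(2 + γ)) := by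
    intro u hu v hv x hx y hy
    rw [uIoc_of_le (by linarith)] at hu hv hx hy
    have h1 : l - 2 ≤ v - y := by linarith [hu.1, hv.1, hx.2, hy.2]
    have h2 : 0 < l - 2 := by linarith
    rw [Real.norm_of_nonneg (by have := h2.trans_le h1; positivity), one_div,
      ← Real.rpow_neg (h2.le.trans h1)]
    exact Real.rpow_le_rpow_of_nonpos h2 h1 (by linarith)
  have step : ∀ {a b : ℝ} {f : ℝ → ℝ} {C : ℝ}, b - a = 1 → (∀ x ∈ uIoc a b, ‖f x‖ ≤ C) →
      ‖∫ x in a..b, f x‖ ≤ C := fun hab hf ↦ by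
    simpa [hab] using intervalIntegral.norm_integral_le_of_norm_le_const hf
  exact step (by ring) fun u hu ↦ step (by ring) fun v hv ↦ step (by ring) fun x hx ↦
    step (by ring) fun y hy ↦ hb u hu v hv x hx y hy

/-- The constant does not depend on `h`, as is required when averaging over directions. For `m ≥ 3`
the product of factors in `mul_rho` is at most 12 and the decay `(m-2)^(2h-4)` is weakened to
`(m-2)^(-2) ≤ 16/(m+1)²`. For `m ≤ 2` the crude bound is `16 * 16 / 2 = 128`, and `128 * 9 = 1152`.
-/
theorem abs_fbmCov_le {h : ℝ} (hh : h ∈ Ioo (0 : ℝ) 1) (m : ℕ) :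
    |fbmCov h m| ≤ 1152 / ((m : ℝ) + 1) ^ 2 := by
  obtain ⟨h0, h1⟩ := hh
  rcases le_or_gt 3 m with hm | hm
  · have hm' : (3 : ℝ) ≤ m := by exact_mod_cast hm
    have e := mul_rho h0 (by linarith : (2 : ℝ) ≤ m)
    have hr := abs_rho_le (γ := 2 - 2 * h) (by linarith) hm'
    have hc : |2 * h * (2 * h - 1) * (2 * h - 2) * (2 * h - 3)| ≤ 2 * 1 * 2 * 3 := by
      simp only [abs_mul]
      have a1 : |2 * h| ≤ 2 := abs_le.2 ⟨by linarith, by linarith⟩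
      have a2 : |2 * h - 1| ≤ 1 := abs_le.2 ⟨by linarith, by linarith⟩
      have a3 : |2 * h - 2| ≤ 2 := abs_le.2 ⟨by linarith, by linarith⟩
      have a4 : |2 * h - 3| ≤ 3 := abs_le.2 ⟨by linarith, by linarith⟩
      rw [← abs_mul]
      gcongr
    have hp : ((m : ℝ) - 2) ^ (-(2 + (2 - 2 * h))) ≤ ((m : ℝ) - 2) ^ (-(2 : ℝ)) :=
      Real.rpow_le_rpow_of_exponent_le (by linarith) (by linarith)
    have hq : ((m : ℝ) - 2) ^ (-(2 : ℝ)) ≤ 16 / ((m : ℝ) + 1) ^ 2 := by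
      rw [Real.rpow_neg (by linarith), Real.rpow_two, ← one_div,
        div_le_div_iff₀ (by have : (0 : ℝ) < m - 2 := by linarith
                            positivity) (by positivity)]
      nlinarith
    have h2 : 2 * |fbmCov h m| ≤ 12 * (16 / ((m : ℝ) + 1) ^ 2) := by
      rw [← abs_two, ← abs_mul, ← abs_neg, ← neg_mul, ← e, abs_mul]
      calc _ ≤ (2 * 1 * 2 * 3) * (16 / ((m : ℝ) + 1) ^ 2) := by
            gcongr
            exact hr.trans (hp.trans hq)
        _ = _ := by ring
    calc |fbmCov h m| ≤ 96 * (1 / ((m : ℝ) + 1) ^ 2) := by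
          rw [← mul_div_assoc, mul_one]
          rw [← mul_div_assoc] at h2
          have : (12 : ℝ) * 16 / ((m : ℝ) + 1) ^ 2 = 2 * (96 / ((m : ℝ) + 1) ^ 2) := by ring
          linarith
      _ ≤ 1152 * (1 / ((m : ℝ) + 1) ^ 2) := by gcongr; norm_num
      _ = _ := by ring
  · have hm' : (m : ℝ) ≤ 2 := by exact_mod_cast Nat.lt_succ_iff.1 hm
    have hm0 : (0 : ℝ) ≤ m := by positivity
    have hb : ∀ x : ℝ, |x| ≤ 4 → |x| ^ (2 * h) ∈ Icc (0 : ℝ) 16 := fun x hx ↦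
      ⟨by positivity, by
        calc |x| ^ (2 * h) ≤ 4 ^ (2 * h) := Real.rpow_le_rpow (abs_nonneg _) hx (by linarith)
          _ ≤ (4 : ℝ) ^ (2 : ℝ) := Real.rpow_le_rpow_of_exponent_le (by norm_num) (by linarith)
          _ = 16 := by norm_num⟩
    have b1 := hb (m + 2) (abs_le.2 ⟨by linarith, by linarith⟩)
    have b2 := hb (m + 1) (abs_le.2 ⟨by linarith, by linarith⟩)
    have b3 := hb m (abs_le.2 ⟨by linarith, by linarith⟩)
    have b4 := hb (m - 1) (abs_le.2 ⟨by linarith, by linarith⟩)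
    have b5 := hb (m - 2) (abs_le.2 ⟨by linarith, by linarith⟩)
    have : |fbmCov h m| ≤ 128 := by
      rw [fbmCov, abs_le]
      constructor <;> linarith [b1.1, b1.2, b2.1, b2.2, b3.1, b3.2, b4.1, b4.2, b5.1, b5.2]
    refine this.trans ?_
    rw [le_div_iff₀ (by positivity)]
    nlinarith

theorem summable_one_div_succ_sq : Summable fun m : ℕ ↦ 1 / ((m : ℝ) + 1) ^ 2 := by
  have := (summable_nat_add_iff 1).2 (Real.summable_one_div_nat_pow.2 one_lt_two)
  simpa using this

theorem fbmCov_zero {h : ℝ} (hh : 0 < h) : fbmCov h 0 = 4 - 2 ^ (2 * h) := by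
  simp only [fbmCov, zero_add, zero_sub, abs_neg, abs_one, abs_two, abs_zero, Real.one_rpow,
    Real.zero_rpow (by linarith : 2 * h ≠ 0)]
  ring

theorem summable_fbmCov_sq {h : ℝ} (hh : h ∈ Ioo (0 : ℝ) 1) :
    Summable fun m : ℕ ↦ fbmCov h m ^ 2 := by
  refine Summable.of_nonneg_of_le (fun _ ↦ sq_nonneg _) (fun m ↦ ?_)
    (summable_one_div_succ_sq.mul_left (1152 ^ 2))
  rw [← sq_abs]
  calc |fbmCov h m| ^ 2 ≤ (1152 / ((m : ℝ) + 1) ^ 2) ^ 2 := by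
        gcongr
        exact abs_fbmCov_le hh m
    _ = 1152 ^ 2 * (1 / ((m : ℝ) + 1) ^ 2) ^ 2 := by ring
    _ ≤ 1152 ^ 2 * (1 / ((m : ℝ) + 1) ^ 2) := by
        gcongr
        refine pow_le_of_le_one (by positivity) ?_ two_ne_zero
        rw [div_le_one (by positivity)]
        have : (0 : ℝ) ≤ m := by positivity
        nlinarith

/-- The variance constant is twice the sum over all integer lags of the squared covariances: its
first two terms are the lags `0` and `±1`, and `mul_rho` identifies the `rho` series with the lags
`|m| ≥ 2`. -/
theorem sigmaSqFBM_eq {h : ℝ} (hh : h ∈ Ioo (0 : ℝ) 1) :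
    sigmaSqFBM h = 2 * (fbmCov h 0 ^ 2 + 2 * ∑' m : ℕ, fbmCov h (m + 1) ^ 2) := by
  have hs : Summable fun m : ℕ ↦ fbmCov h (m + 1) ^ 2 := by
    simpa using (summable_nat_add_iff 1).2 (summable_fbmCov_sq hh)
  have h1 : fbmCov h 1 = (2 ^ (2 * h + 2) - 7 - 3 ^ (2 * h)) / 2 := by
    have : (1 : ℝ) + 2 = 3 := by norm_num
    have e1 : (1 : ℝ) + 1 = 2 := by norm_num
    have e2 : (1 : ℝ) - 2 = -1 := by norm_num
    rw [fbmCov, this, e1, e2, sub_self, abs_neg, abs_one, abs_zero, abs_two, Real.one_rpow,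
      Real.zero_rpow (by linarith [hh.1] : 2 * h ≠ 0), Real.rpow_add two_pos,
      abs_of_pos (by norm_num : (0 : ℝ) < 3), Real.rpow_two]
    ring
  have hρ : ∀ m : ℕ, (2 * h) ^ 2 * (2 * h - 1) ^ 2 * (2 * h - 2) ^ 2 * (2 * h - 3) ^ 2 *
      rho (2 - 2 * h) ((m : ℝ) + 2) 0 ^ 2 = 4 * fbmCov h (((m + 1 : ℕ) : ℝ) + 1) ^ 2 := fun m ↦ by
    have := mul_rho hh.1 (by linarith [(Nat.cast_nonneg m : (0 : ℝ) ≤ m)] : (2 : ℝ) ≤ m + 2)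
    have e : (((m + 1 : ℕ) : ℝ) + 1) = (m : ℝ) + 2 := by push_cast; ring
    rw [e]
    calc _ = (2 * h * (2 * h - 1) * (2 * h - 2) * (2 * h - 3) *
          rho (2 - 2 * h) ((m : ℝ) + 2) 0) ^ 2 := by ring
      _ = _ := by rw [this]; ring
  rw [sigmaSqFBM, rhoNormSq, ← tsum_mul_left, hs.tsum_eq_zero_add]
  simp_rw [hρ]
  rw [tsum_mul_left, fbmCov_zero hh.1, Nat.cast_zero, zero_add, h1]
  ring

/-! ### Square integrable functions -/

section L2

variable {α : Type*} [MeasurableSpace α] {μ : Measure α}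

theorem eLpNorm_two_eq {E : Type*} [NormedAddCommGroup E] {g : α → E} (hg : MemLp g 2 μ) :
    eLpNorm g 2 μ = ENNReal.ofReal √(∫ x, ‖g x‖ ^ 2 ∂μ) := by
  rw [hg.eLpNorm_eq_integral_rpow_norm two_ne_zero ENNReal.ofNat_ne_top, Real.sqrt_eq_rpow]
  simp

theorem integral_mul_conj_self (g : α → ℂ) :
    ∫ x, g x * conj (g x) ∂μ = ((∫ x, ‖g x‖ ^ 2 ∂μ : ℝ) : ℂ) := by
  rw [← integral_complex_ofReal]
  exact integral_congr_ae (.of_forall fun x ↦ by simp [Complex.mul_conj'])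

theorem integral_sum_mul_conj_sum {ι κ : Type*} {f : ι → α → ℂ} {g : κ → α → ℂ}
    (hf : ∀ i, MemLp (f i) 2 μ) (hg : ∀ i, MemLp (g i) 2 μ) (s : Finset ι) (t : Finset κ)
    (c : ι → ℂ) (d : κ → ℂ) :
    ∫ x, (∑ i ∈ s, c i * f i x) * conj (∑ j ∈ t, d j * g j x) ∂μ =
      ∑ i ∈ s, ∑ j ∈ t, c i * conj (d j) * ∫ x, f i x * conj (g j x) ∂μ := by
  have hint : ∀ i j, Integrable (fun x ↦ f i x * conj (g j x)) μ := fun i j ↦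
    (hf i).integrable_mul (hg j).star
  have e : ∀ x, (∑ i ∈ s, c i * f i x) * conj (∑ j ∈ t, d j * g j x) =
      ∑ i ∈ s, ∑ j ∈ t, c i * conj (d j) * (f i x * conj (g j x)) := fun x ↦ by
    rw [map_sum, Finset.sum_mul_sum]
    refine Finset.sum_congr rfl fun i _ ↦ Finset.sum_congr rfl fun j _ ↦ ?_
    rw [map_mul]
    ring
  simp_rw [e]
  rw [integral_finsetSum _ fun i _ ↦ integrable_finsetSum _ fun j _ ↦ (hint i j).const_mul _]
  refine Finset.sum_congr rfl fun i _ ↦ ?_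
  rw [integral_finsetSum _ fun j _ ↦ (hint i j).const_mul _]
  simp_rw [integral_const_mul]

theorem tendsto_eLpNorm_of_sub {E : Type*} [NormedAddCommGroup E] {f : ℕ → α → E} {g : α → E}
    (hf : ∀ n, AEStronglyMeasurable (f n) μ) (hg : AEStronglyMeasurable g μ)
    (h : Tendsto (fun n ↦ eLpNorm (fun x ↦ f n x - g x) 2 μ) atTop (𝓝 0)) :
    Tendsto (fun n ↦ eLpNorm (f n) 2 μ) atTop (𝓝 (eLpNorm g 2 μ)) := by
  have one_le : (1 : ENNReal) ≤ 2 := one_le_two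
  have h1 : ∀ n, eLpNorm (f n) 2 μ ≤ eLpNorm g 2 μ + eLpNorm (fun x ↦ f n x - g x) 2 μ :=
    fun n ↦ by
      have := eLpNorm_add_le hg ((hf n).sub hg) one_le
      rwa [add_sub_cancel] at this
  have h2 : ∀ n, eLpNorm g 2 μ - eLpNorm (fun x ↦ f n x - g x) 2 μ ≤ eLpNorm (f n) 2 μ :=
    fun n ↦ tsub_le_iff_right.2 (by
      have := eLpNorm_sub_le (hf n) ((hf n).sub hg) one_le
      rwa [sub_sub_cancel] at this)
  refine tendsto_of_tendsto_of_tendsto_of_le_of_le ?_ ?_ h2 h1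
  · simpa using ENNReal.Tendsto.sub (tendsto_const_nhds (x := eLpNorm g 2 μ)) h
      (.inr ENNReal.zero_ne_top)
  · simpa using (tendsto_const_nhds (x := eLpNorm g 2 μ)).add h

end L2

/-! ### The stochastic integral -/

section StochasticIntegral

variable {Ω : Type*} {d : ℕ} {W : FiniteBorel d → Ω → ℂ}

theorem stepFunction_add (c c' : FiniteBorel d →₀ ℂ) (ξ : EuclideanSpace ℝ (Fin d)) :
    stepFunction (c + c') ξ = stepFunction c ξ + stepFunction c' ξ :=
  Finsupp.sum_add_index' (fun S ↦ by simp) fun S a b ↦ by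
    by_cases h : ξ ∈ S.1 <;> simp [h]

theorem stepIntegral_add (c c' : FiniteBorel d →₀ ℂ) (ω : Ω) :
    stepIntegral W (c + c') ω = stepIntegral W c ω + stepIntegral W c' ω :=
  Finsupp.sum_add_index' (fun S ↦ by simp) fun S a b ↦ add_mul _ _ _

theorem stepFunction_smul (b : ℂ) (c : FiniteBorel d →₀ ℂ) (ξ : EuclideanSpace ℝ (Fin d)) :
    stepFunction (b • c) ξ = b * stepFunction c ξ := by
  rw [stepFunction, Finsupp.sum_smul_index (fun S ↦ by simp), stepFunction, Finsupp.mul_sum]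
  refine Finsupp.sum_congr fun S _ ↦ ?_
  by_cases h : ξ ∈ S.1 <;> simp [h]

theorem stepIntegral_smul (b : ℂ) (c : FiniteBorel d →₀ ℂ) (ω : Ω) :
    stepIntegral W (b • c) ω = b * stepIntegral W c ω := by
  rw [stepIntegral, Finsupp.sum_smul_index (fun S ↦ by simp), stepIntegral, Finsupp.mul_sum]
  exact Finsupp.sum_congr fun S _ ↦ mul_assoc _ _ _

theorem stepFunction_eq (c : FiniteBorel d →₀ ℂ) :
    stepFunction c = fun ξ ↦ ∑ S ∈ c.support, c S * S.1.indicator (fun _ ↦ (1 : ℂ)) ξ := by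
  ext ξ
  refine Finset.sum_congr rfl fun S _ ↦ ?_
  by_cases h : ξ ∈ S.1 <;> simp [h]

theorem stepIntegral_eq (c : FiniteBorel d →₀ ℂ) :
    stepIntegral W c = fun ω ↦ ∑ S ∈ c.support, c S * W S ω := rfl

variable [MeasurableSpace Ω] {P : Measure Ω}

theorem memLp_indicator_finiteBorel (S : FiniteBorel d) :
    MemLp (S.1.indicator fun _ ↦ (1 : ℂ)) 2 (volume : Measure (EuclideanSpace ℝ (Fin d))) :=
  memLp_indicator_const 2 S.2.1 1 (.inr S.2.2.ne)

theorem memLp_stepFunction (c : FiniteBorel d →₀ ℂ) : MemLp (stepFunction c) 2 volume := by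
  rw [stepFunction_eq]
  exact memLp_finsetSum _ fun S _ ↦ (memLp_indicator_finiteBorel S).const_mul _

theorem IsComplexGaussianMeasure.memLp (hW : IsComplexGaussianMeasure W P) (S : FiniteBorel d) :
    MemLp (W S) 2 P :=
  (hW.isGaussianProcess.hasGaussianLaw_eval S).memLp_two

theorem IsComplexGaussianMeasure.memLp_stepIntegral (hW : IsComplexGaussianMeasure W P)
    (c : FiniteBorel d →₀ ℂ) : MemLp (stepIntegral W c) 2 P := by
  rw [stepIntegral_eq]
  exact memLp_finsetSum _ fun S _ ↦ (hW.memLp S).const_mul _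

/-- The isometry property of the elementary integral. -/
theorem IsComplexGaussianMeasure.eLpNorm_stepIntegral (hW : IsComplexGaussianMeasure W P)
    (c : FiniteBorel d →₀ ℂ) :
    eLpNorm (stepIntegral W c) 2 P = eLpNorm (stepFunction c) 2 volume := by
  rw [eLpNorm_two_eq (hW.memLp_stepIntegral c), eLpNorm_two_eq (memLp_stepFunction c)]
  congr 2
  rw [← Complex.ofReal_inj, ← integral_mul_conj_self, ← integral_mul_conj_self, stepIntegral_eq,
    stepFunction_eq, integral_sum_mul_conj_sum hW.memLp hW.memLp,
    integral_sum_mul_conj_sum memLp_indicator_finiteBorel memLp_indicator_finiteBorel]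
  refine Finset.sum_congr rfl fun S _ ↦ Finset.sum_congr rfl fun T _ ↦ ?_
  rw [hW.covariance]
  congr 1
  have : ∀ ξ, S.1.indicator (fun _ ↦ (1 : ℂ)) ξ * conj (T.1.indicator (fun _ ↦ (1 : ℂ)) ξ) =
      (S.1 ∩ T.1).indicator (fun _ ↦ (1 : ℂ)) ξ := fun ξ ↦ by
    by_cases h : ξ ∈ S.1 <;> by_cases h' : ξ ∈ T.1 <;> simp [h, h']
  simp_rw [this]
  rw [integral_indicator_const _ (S.2.1.inter T.2.1)]
  simp

theorem isStochasticIntegral_zero :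
    IsStochasticIntegral W P (fun _ : EuclideanSpace ℝ (Fin d) ↦ 0) (fun _ ↦ 0) :=
  ⟨aestronglyMeasurable_const, aestronglyMeasurable_const, fun _ ↦ 0,
    by simp [stepFunction], by simp [stepIntegral]⟩

variable {f g : EuclideanSpace ℝ (Fin d) → ℂ} {X Y : Ω → ℂ}

theorem IsStochasticIntegral.const_mul (h : IsStochasticIntegral W P f X) (b : ℂ) :
    IsStochasticIntegral W P (fun ξ ↦ b * f ξ) (fun ω ↦ b * X ω) := by
  obtain ⟨hf, hX, c, h1, h2⟩ := h
  refine ⟨hf.const_mul b, hX.const_mul b, fun m ↦ b • c m, ?_, ?_⟩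
  · have e : ∀ m, (fun ξ ↦ stepFunction (b • c m) ξ - b * f ξ) =
        b • fun ξ ↦ stepFunction (c m) ξ - f ξ := fun m ↦ by
      ext ξ; simp [stepFunction_smul, mul_sub]
    simp_rw [e, eLpNorm_const_smul]
    simpa using ENNReal.Tendsto.const_mul h1 (.inr (by simp))
  · have e : ∀ m, (fun ω ↦ stepIntegral W (b • c m) ω - b * X ω) =
        b • fun ω ↦ stepIntegral W (c m) ω - X ω := fun m ↦ by
      ext ξ; simp [stepIntegral_smul, mul_sub]
    simp_rw [e, eLpNorm_const_smul]
    simpa using ENNReal.Tendsto.const_mul h2 (.inr (by simp))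

theorem IsStochasticIntegral.add (hW : IsComplexGaussianMeasure W P)
    (h : IsStochasticIntegral W P f X) (h' : IsStochasticIntegral W P g Y) :
    IsStochasticIntegral W P (fun ξ ↦ f ξ + g ξ) (fun ω ↦ X ω + Y ω) := by
  obtain ⟨hf, hX, c, h1, h2⟩ := h
  obtain ⟨hg, hY, c', h1', h2'⟩ := h'
  refine ⟨hf.add hg, hX.add hY, fun m ↦ c m + c' m, ?_, ?_⟩
  · refine tendsto_of_tendsto_of_tendsto_of_le_of_le tendsto_const_nhds
      (by simpa using h1.add h1') (fun _ ↦ zero_le) fun m ↦ ?_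
    have e : (fun ξ ↦ stepFunction (c m + c' m) ξ - (f ξ + g ξ)) =
        (fun ξ ↦ stepFunction (c m) ξ - f ξ) + fun ξ ↦ stepFunction (c' m) ξ - g ξ := by
      ext ξ; simp [stepFunction_add]; ring
    simp only [e]
    exact eLpNorm_add_le ((memLp_stepFunction _).1.sub hf) ((memLp_stepFunction _).1.sub hg)
      one_le_two
  · refine tendsto_of_tendsto_of_tendsto_of_le_of_le tendsto_const_nhds
      (by simpa using h2.add h2') (fun _ ↦ zero_le) fun m ↦ ?_
    have e : (fun ω ↦ stepIntegral W (c m + c' m) ω - (X ω + Y ω)) =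
        (fun ω ↦ stepIntegral W (c m) ω - X ω) + fun ω ↦ stepIntegral W (c' m) ω - Y ω := by
      ext ξ; simp [stepIntegral_add]; ring
    simp only [e]
    exact eLpNorm_add_le ((hW.memLp_stepIntegral _).1.sub hX) ((hW.memLp_stepIntegral _).1.sub hY)
      one_le_two

theorem IsStochasticIntegral.sum (hW : IsComplexGaussianMeasure W P) {ι : Type*} (s : Finset ι)
    {f : ι → EuclideanSpace ℝ (Fin d) → ℂ} {X : ι → Ω → ℂ}
    (h : ∀ i, IsStochasticIntegral W P (f i) (X i)) (b : ι → ℂ) :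
    IsStochasticIntegral W P (fun ξ ↦ ∑ i ∈ s, b i * f i ξ) (fun ω ↦ ∑ i ∈ s, b i * X i ω) := by
  classical
  induction s using Finset.induction_on with
  | empty => simpa using isStochasticIntegral_zero
  | insert i s hi ih =>
    simp_rw [Finset.sum_insert hi]
    exact ((h i).const_mul (b i)).add hW ih

/-- `f` is a step function minus an error which has finite norm as soon as the approximation is good
enough. -/
theorem IsStochasticIntegral.memLp (h : IsStochasticIntegral W P f X) : MemLp f 2 volume := by
  obtain ⟨hf, _, c, h1, _⟩ := h
  obtain ⟨m, hm⟩ := (h1.eventually_lt_const ENNReal.zero_lt_top).exists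
  have h2 : MemLp (fun ξ ↦ stepFunction (c m) ξ - f ξ) 2 volume :=
    ⟨(memLp_stepFunction _).1.sub hf, hm⟩
  have := (memLp_stepFunction (c m)).sub h2
  convert! this using 1
  ext ξ
  simp

theorem IsStochasticIntegral.eLpNorm_eq (hW : IsComplexGaussianMeasure W P)
    (h : IsStochasticIntegral W P f X) : eLpNorm X 2 P = eLpNorm f 2 volume := by
  obtain ⟨hf, hX, c, h1, h2⟩ := h
  refine tendsto_nhds_unique (tendsto_eLpNorm_of_sub (fun m ↦ (hW.memLp_stepIntegral _).1) hX h2) ?_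
  simp_rw [hW.eLpNorm_stepIntegral]
  exact tendsto_eLpNorm_of_sub (fun m ↦ (memLp_stepFunction _).1) hf h1

/-- The approximating elementary integrals may be complex even when their limit is real. Their real
parts are real-linear in finitely many `W(S)`, hence Gaussian, and they have the same limit. -/
theorem IsComplexGaussianMeasure.hasGaussianLaw_re_stepIntegral
    (hW : IsComplexGaussianMeasure W P) (c : FiniteBorel d →₀ ℂ) :
    HasGaussianLaw (fun ω ↦ (stepIntegral W c ω).re) P := by
  let L : (c.support → ℂ) →L[ℝ] ℝ :=
    ∑ S : c.support, Complex.reCLM ∘L ((ContinuousLinearMap.mul ℝ ℂ (c S)) ∘L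
      (ContinuousLinearMap.proj S))
  have := (hW.isGaussianProcess.hasGaussianLaw c.support).map_fun L
  refine this.congr (.of_forall fun ω ↦ ?_)
  rw [stepIntegral_eq]
  simp only [L, sum_apply, Complex.re_sum, ContinuousLinearMap.comp_apply,
    Complex.reCLM_apply, ContinuousLinearMap.mul_apply', ContinuousLinearMap.proj_apply,
    Finset.restrict]
  exact (Finset.sum_coe_sort c.support (fun S ↦ (c S * W S ω).re))

theorem IsComplexGaussianMeasure.map_re_stepIntegral (hW : IsComplexGaussianMeasure W P)
    (c : FiniteBorel d →₀ ℂ) :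
    P.map (fun ω ↦ (stepIntegral W c ω).re) =
      gaussianReal 0 ((eLpNorm (fun ω ↦ (stepIntegral W c ω).re) 2 P).toReal ^ 2).toNNReal := by
  have : IsProbabilityMeasure P := hW.isGaussianProcess.isProbabilityMeasure
  have hint : Integrable (stepIntegral W c) P := (hW.memLp_stepIntegral c).integrable one_le_two
  have h0 : ∫ ω, stepIntegral W c ω ∂P = 0 := by
    rw [stepIntegral_eq,
      integral_finsetSum _ fun S _ ↦ ((hW.memLp S).integrable one_le_two).const_mul _]
    simp [integral_const_mul, hW.integral_eq_zero]
  have h1 : ∫ ω, (stepIntegral W c ω).re ∂P = 0 := by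
    have := integral_re hint
    simp only [RCLike.re_to_complex] at this
    rw [this, h0, Complex.zero_re]
  have hm := (hW.hasGaussianLaw_re_stepIntegral c).memLp_two
  rw [(hW.hasGaussianLaw_re_stepIntegral c).map_eq_gaussianReal, h1,
    variance_of_integral_eq_zero hm.1.aemeasurable h1, eLpNorm_two_eq hm,
    ENNReal.toReal_ofReal (Real.sqrt_nonneg _), Real.sq_sqrt (by positivity)]
  simp

/-- A real stochastic integral `∫ f dW` is a centered Gaussian variable with variance `∫ |f|²`. -/
theorem IsStochasticIntegral.map_eq_gaussianReal (hW : IsComplexGaussianMeasure W P)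
    {X : Ω → ℝ} (h : IsStochasticIntegral W P f fun ω ↦ (X ω : ℂ)) :
    P.map X = gaussianReal 0 (∫ ξ, ‖f ξ‖ ^ 2).toNNReal := by
  have : IsProbabilityMeasure P := hW.isGaussianProcess.isProbabilityMeasure
  have hnorm := h.eLpNorm_eq hW
  have hmem := h.memLp
  obtain ⟨hf, hX, c, h1, h2⟩ := h
  have hX' : AEStronglyMeasurable X P := by
    simpa using Complex.continuous_re.comp_aestronglyMeasurable hX
  have hR : ∀ m, AEStronglyMeasurable (fun ω ↦ (stepIntegral W (c m) ω).re) P := fun m ↦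
    (hW.hasGaussianLaw_re_stepIntegral _).memLp_two.1
  have h3 : Tendsto (fun m ↦ eLpNorm (fun ω ↦ (stepIntegral W (c m) ω).re - X ω) 2 P) atTop
      (𝓝 0) := by
    refine tendsto_of_tendsto_of_tendsto_of_le_of_le tendsto_const_nhds h2 (fun _ ↦ zero_le)
      fun m ↦ eLpNorm_mono fun ω ↦ ?_
    simpa using Complex.abs_re_le_norm (stepIntegral W (c m) ω - X ω)
  have hXm : AEMeasurable X P := hX'.aemeasurable
  -- The real parts converge in `L²` to `X` itself, so their norms tend to that of `X`, which the
  -- isometry equates with that of `f`.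
  have hv : Tendsto (fun m ↦ eLpNorm (fun ω ↦ (stepIntegral W (c m) ω).re) 2 P) atTop
      (𝓝 (ENNReal.ofReal √(∫ ξ, ‖f ξ‖ ^ 2))) := by
    rw [← eLpNorm_two_eq hmem, ← hnorm]
    have e : eLpNorm (fun ω ↦ (X ω : ℂ)) 2 P = eLpNorm X 2 P :=
      eLpNorm_congr_norm_ae (.of_forall fun ω ↦ by simp)
    rw [e]
    exact tendsto_eLpNorm_of_sub hR hX' h3
  have hd : TendstoInDistribution (fun m ω ↦ (stepIntegral W (c m) ω).re) atTop X (fun _ ↦ P) P :=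
    (tendstoInMeasure_of_tendsto_eLpNorm two_ne_zero hR hX' h3).tendstoInDistribution
      fun m ↦ (hR m).aemeasurable
  have : IsProbabilityMeasure (P.map X) := Measure.isProbabilityMeasure_map hXm
  -- The characteristic functions of the approximations tend to that of `X`, and also to the
  -- Gaussian one because their variances converge; limits are unique.
  refine Measure.ext_of_charFun (funext fun t ↦ ?_)
  have hc := ProbabilityMeasure.tendsto_iff_tendsto_charFun.1 hd.tendsto t
  simp only [ProbabilityMeasure.coe_mk, hW.map_re_stepIntegral, charFun_gaussianReal] at hc
  refine tendsto_nhds_unique hc ?_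
  rw [charFun_gaussianReal]
  have hv' : Tendsto (fun m ↦ ((eLpNorm (fun ω ↦ (stepIntegral W (c m) ω).re) 2 P).toReal ^ 2))
      atTop (𝓝 (∫ ξ, ‖f ξ‖ ^ 2)) := by
    have := ((ENNReal.tendsto_toReal ENNReal.ofReal_ne_top).comp hv).pow 2
    rwa [ENNReal.toReal_ofReal (Real.sqrt_nonneg _), Real.sq_sqrt (by positivity)] at this
  have hv'' := (continuous_real_toNNReal.tendsto _).comp hv'
  have hcont : Continuous fun v : NNReal ↦ Complex.exp (t * (0 : ℝ) * Complex.I - v * t ^ 2 / 2) := by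
    fun_prop
  exact (hcont.tendsto _).comp hv''

end StochasticIntegral

/-! ### Quadratic forms in Gaussian variables -/

/-- A Gaussian integral with complex parameter `b`. Since `1 - 2isv` has positive real part, the
principal logarithm is the right branch; keeping `exp(-log/2)` turns products over eigenvalues into
sums. -/
theorem integral_exp_sq_gaussianReal (v : NNReal) (s : ℝ) :
    ∫ x, Complex.exp (s * (x : ℂ) ^ 2 * Complex.I) ∂(gaussianReal 0 v) =
      Complex.exp (-(1 / 2) * Complex.log (1 - 2 * s * v * Complex.I)) := by
  rcases eq_or_ne v 0 with rfl | hv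
  · simp
  have hv0 : (0 : ℝ) < v := by positivity
  let b : ℂ := 1 / (2 * v) - s * Complex.I
  have hb : 0 < b.re := by
    have e : (1 / (2 * v) : ℂ) = ((1 / (2 * v) : ℝ) : ℂ) := by push_cast; ring
    simp only [b, e, Complex.sub_re, Complex.ofReal_re, Complex.mul_re, Complex.I_re, mul_zero,
      Complex.ofReal_im, Complex.I_im, mul_one, sub_zero, sub_self]
    positivity
  have hvC : (v : ℂ) ≠ 0 := by exact_mod_cast hv0.ne'
  have hbz : b ≠ 0 := fun h ↦ by simp [h] at hb
  let z : ℂ := 1 - 2 * s * v * Complex.I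
  have hzb : z = ((2 * v : ℝ) : ℂ) * b := by
    simp only [z, b]
    push_cast
    field_simp
  have hz : 0 < z.re := by simp [z]
  have hz0 : z ≠ 0 := fun h ↦ by simp [h] at hz
  rw [integral_gaussianReal_eq_integral_smul hv]
  have e : ∀ x : ℝ, gaussianPDFReal 0 v x • Complex.exp (s * (x : ℂ) ^ 2 * Complex.I) =
      ((√(2 * Real.pi * v))⁻¹ : ℝ) * Complex.exp (-b * (x : ℂ) ^ 2) := fun x ↦ by
    rw [gaussianPDFReal, Complex.real_smul]
    push_cast
    rw [mul_assoc, ← Complex.exp_add]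
    congr 2
    simp only [b]
    field_simp
    ring
  simp_rw [e]
  rw [integral_const_mul, integral_gaussian_complex hb]
  have hp : (0 : ℝ) < 2 * Real.pi * v := by positivity
  have e2 : (Real.pi : ℂ) / b = ((2 * Real.pi * v : ℝ) : ℂ) * z⁻¹ := by
    rw [hzb]
    push_cast
    field_simp
  have harg : z.arg ≠ Real.pi := by
    intro h
    rw [Complex.arg_eq_pi_iff] at h
    linarith [h.1]
  rw [e2, Complex.cpow_def_of_ne_zero (mul_ne_zero (by exact_mod_cast hp.ne') (inv_ne_zero hz0)),
    Complex.log_ofReal_mul hp (inv_ne_zero hz0), Complex.log_inv _ harg, add_mul, Complex.exp_add,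
    ← mul_assoc]
  have e3 : Complex.exp (((Real.log (2 * Real.pi * v) : ℝ) : ℂ) * (1 / 2)) =
      ((√(2 * Real.pi * v) : ℝ) : ℂ) := by
    rw [Real.sqrt_eq_rpow, Real.rpow_def_of_pos hp]
    push_cast
    rfl
  rw [e3, ← Complex.ofReal_mul, inv_mul_cancel₀ (Real.sqrt_ne_zero'.2 hp), Complex.ofReal_one,
    one_mul]
  congr 1
  ring

section QuadraticForm

variable {Ω : Type*} [MeasurableSpace Ω] {d : ℕ} {W : FiniteBorel d → Ω → ℂ} {P : Measure Ω}
  {ι : Type*}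

/-- The real Gram matrix of a family of functions. -/
noncomputable def gram (f : ι → EuclideanSpace ℝ (Fin d) → ℂ) : Matrix ι ι ℝ :=
  Matrix.of fun i j ↦ ∫ ξ, (f i ξ * conj (f j ξ)).re

theorem gram_isHermitian (f : ι → EuclideanSpace ℝ (Fin d) → ℂ) : (gram f).IsHermitian := by
  ext i j
  simp only [gram, Matrix.conjTranspose_apply, Matrix.of_apply, star_trivial]
  refine integral_congr_ae (.of_forall fun ξ ↦ ?_)
  simp only [Complex.mul_re, Complex.conj_re, Complex.conj_im]
  ring

variable [Fintype ι]

theorem integral_norm_sum_sq {f : ι → EuclideanSpace ℝ (Fin d) → ℂ} (hf : ∀ i, MemLp (f i) 2 volume)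
    (x : ι → ℝ) :
    ∫ ξ, ‖∑ i, (x i : ℂ) * f i ξ‖ ^ 2 = x ⬝ᵥ (gram f).mulVec x := by
  rw [← Complex.ofReal_re (∫ ξ, ‖∑ i, (x i : ℂ) * f i ξ‖ ^ 2), ← integral_mul_conj_self,
    integral_sum_mul_conj_sum hf hf, Complex.re_sum]
  simp only [dotProduct, Matrix.mulVec, Finset.mul_sum]
  refine Finset.sum_congr rfl fun i _ ↦ ?_
  rw [Complex.re_sum]
  refine Finset.sum_congr rfl fun j _ ↦ ?_
  have hre : (∫ ξ, f i ξ * conj (f j ξ)).re = gram f i j := by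
    have := integral_re (μ := volume) (f := fun ξ ↦ f i ξ * conj (f j ξ))
      ((hf i).integrable_mul (hf j).star)
    simp only [RCLike.re_to_complex] at this
    rw [← this]
    rfl
  rw [Complex.conj_ofReal, ← Complex.ofReal_mul, Complex.re_ofReal_mul, hre]
  ring

variable [DecidableEq ι]

theorem gram_eigenvalues_nonneg {f : ι → EuclideanSpace ℝ (Fin d) → ℂ}
    (hf : ∀ i, MemLp (f i) 2 volume) (i : ι) : 0 ≤ (gram_isHermitian f).eigenvalues i := by
  refine Matrix.PosSemidef.eigenvalues_nonneg (.of_dotProduct_mulVec_nonneg (gram_isHermitian f)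
    fun x ↦ ?_) i
  rw [star_trivial, ← integral_norm_sum_sq hf]
  positivity

/-- Both sides equal the trace of `G²`. -/
theorem sum_eigenvalues_sq {G : Matrix ι ι ℝ} (hG : G.IsHermitian) :
    ∑ i, hG.eigenvalues i ^ 2 = ∑ i, ∑ j, G i j ^ 2 := by
  have h1 : (G * G).trace = ∑ i, ∑ j, G i j ^ 2 := by
    simp only [Matrix.trace, Matrix.diag, Matrix.mul_apply]
    refine Finset.sum_congr rfl fun i _ ↦ Finset.sum_congr rfl fun j _ ↦ ?_
    rw [← hG.apply i j, star_trivial, sq]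
  rw [← h1]
  conv_rhs => rw [hG.spectral_theorem]
  rw [← map_mul, Unitary.conjStarAlgAut_apply, Matrix.trace_mul_cycle]
  simp [Matrix.diagonal_mul_diagonal, Matrix.trace_diagonal, sq]

/-- Gershgorin: the eigenvalue lies within the off-diagonal absolute row sum of some diagonal entry.
-/
theorem eigenvalues_le_of_row_sum_le {G : Matrix ι ι ℝ} (hG : G.IsHermitian) {C : ℝ}
    (hC : ∀ i, ∑ j, |G i j| ≤ C) (i : ι) : hG.eigenvalues i ≤ C := by
  have hev : Module.End.HasEigenvalue (Matrix.toLin' G) (hG.eigenvalues i) := by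
    refine Module.End.hasEigenvalue_of_hasEigenvector
      (x := ⇑(hG.eigenvectorBasis i)) ⟨?_, fun h ↦ ?_⟩
    · rw [Module.End.mem_eigenspace_iff, Matrix.toLin'_apply, hG.mulVec_eigenvectorBasis]
    · exact hG.eigenvectorBasis.toBasis.ne_zero i (by
        rw [OrthonormalBasis.coe_toBasis]
        ext j
        exact congrFun h j)
  obtain ⟨k, hk⟩ := eigenvalue_mem_ball hev
  rw [Metric.mem_closedBall, Real.dist_eq] at hk
  have h1 := (abs_le.1 hk).2
  have h2 := hC k
  rw [← Finset.add_sum_erase _ _ (Finset.mem_univ k)] at h2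
  simp only [Real.norm_eq_abs] at h1
  linarith [le_abs_self (G k k)]

/-- The law of the coordinates of a Gaussian vector in an eigenbasis of its covariance matrix. -/
theorem map_eigenbasis_coordinates (hW : IsComplexGaussianMeasure W P)
    {f : ι → EuclideanSpace ℝ (Fin d) → ℂ} {Y : ι → Ω → ℝ}
    (h : ∀ i, IsStochasticIntegral W P (f i) fun ω ↦ (Y i ω : ℂ)) :
    P.map (fun ω i ↦ ∑ j, (gram_isHermitian f).eigenvectorBasis i j * Y j ω) =
      Measure.pi fun i ↦ gaussianReal 0 ((gram_isHermitian f).eigenvalues i).toNNReal := by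
  have : IsProbabilityMeasure P := hW.isGaussianProcess.isProbabilityMeasure
  set hG := gram_isHermitian f
  have hf := fun i ↦ (h i).memLp
  have hYm : ∀ i, AEMeasurable (Y i) P := fun i ↦ by
    simpa using (Complex.continuous_re.comp_aestronglyMeasurable (h i).2.1).aemeasurable
  have hηm : AEMeasurable (fun ω i ↦ ∑ j, hG.eigenvectorBasis i j * Y j ω) P :=
    aemeasurable_pi_lambda _ fun i ↦ Finset.aemeasurable_fun_sum _ fun j _ ↦ (hYm j).const_mul _
  have := Measure.isProbabilityMeasure_map hηm
  rw [← charFun_eq_pi_iff]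
  intro t
  -- The test vector `t` in eigencoordinates is the vector `x` in the original ones. A linear
  -- combination of the `Y j` is again a stochastic integral, hence a centered Gaussian whose
  -- variance is the quadratic form of the Gram matrix, diagonal in `t`.
  let x : ι → ℝ := fun j ↦ ∑ i, t i * hG.eigenvectorBasis i j
  have hsum := IsStochasticIntegral.sum hW Finset.univ h fun j ↦ (x j : ℂ)
  have hsum' : IsStochasticIntegral W P (fun ξ ↦ ∑ j, (x j : ℂ) * f j ξ)
      fun ω ↦ ((∑ j, x j * Y j ω : ℝ) : ℂ) := by
    simpa using hsum
  have hlaw := hsum'.map_eq_gaussianReal hW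
  have hquad : x ⬝ᵥ (gram f).mulVec x = ∑ i, t i ^ 2 * hG.eigenvalues i := by
    have hx : x = ∑ i, t i • ⇑(hG.eigenvectorBasis i) := by
      ext j
      simp [x]
    have ho : ∀ i k, (⇑(hG.eigenvectorBasis i) : ι → ℝ) ⬝ᵥ ⇑(hG.eigenvectorBasis k) =
        if i = k then 1 else 0 := fun i k ↦ by
      have := orthonormal_iff_ite.1 hG.eigenvectorBasis.orthonormal i k
      rw [← this, EuclideanSpace.inner_eq_star_dotProduct, star_trivial, dotProduct_comm]
    rw [hx, Matrix.mulVec_sum, sum_dotProduct]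
    refine Finset.sum_congr rfl fun i _ ↦ ?_
    simp only [dotProduct_sum, Matrix.mulVec_smul, hG.mulVec_eigenvectorBasis, smul_dotProduct,
      dotProduct_smul, ho, smul_eq_mul, mul_ite, mul_one, mul_zero, Finset.sum_ite_eq,
      Finset.mem_univ, if_true]
    ring
  have hprod : ∏ i, charFun (gaussianReal 0 (hG.eigenvalues i).toNNReal) (t i) =
      charFun (gaussianReal 0 (∑ i, t i ^ 2 * hG.eigenvalues i).toNNReal) 1 := by
    simp only [charFun_gaussianReal]
    rw [← Complex.exp_sum, Real.coe_toNNReal _ (Finset.sum_nonneg fun i _ ↦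
      mul_nonneg (sq_nonneg _) (gram_eigenvalues_nonneg hf i))]
    congr 1
    simp only [Complex.ofReal_zero, mul_zero, zero_mul, zero_sub, Finset.sum_neg_distrib,
      Complex.ofReal_sum, Complex.ofReal_one, one_pow, mul_one, Finset.sum_div]
    congr 1
    refine Finset.sum_congr rfl fun i _ ↦ ?_
    rw [Real.coe_toNNReal _ (gram_eigenvalues_nonneg hf i)]
    push_cast
    ring
  rw [hprod, ← hquad, ← integral_norm_sum_sq hf, ← hlaw, charFun_apply, charFun_apply,
    AEMeasurable.map_map_of_aemeasurable (by fun_prop) hηm, integral_map, integral_map]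
  · refine integral_congr_ae (.of_forall fun ω ↦ ?_)
    simp only [Function.comp]
    congr 3
    simp only [PiLp.inner_apply, RCLike.inner_apply, conj_trivial, x, Finset.sum_mul,
      Finset.mul_sum, one_mul]
    rw [Finset.sum_comm]
    refine Finset.sum_congr rfl fun j _ ↦ Finset.sum_congr rfl fun i _ ↦ ?_
    ring
  · exact Finset.aemeasurable_fun_sum _ fun j _ ↦ (hYm j).const_mul _
  · fun_prop
  · exact AEMeasurable.comp_aemeasurable (by fun_prop) hηm
  · fun_prop

/-- The characteristic function of the squared norm of a Gaussian vector. -/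
theorem integral_exp_sum_sq (hW : IsComplexGaussianMeasure W P)
    {f : ι → EuclideanSpace ℝ (Fin d) → ℂ} {Y : ι → Ω → ℝ}
    (h : ∀ i, IsStochasticIntegral W P (f i) fun ω ↦ (Y i ω : ℂ)) (s : ℝ) :
    ∫ ω, Complex.exp (s * ((∑ i, Y i ω ^ 2 : ℝ) : ℂ) * Complex.I) ∂P =
      Complex.exp (∑ i, -(1 / 2) *
        Complex.log (1 - 2 * s * (gram_isHermitian f).eigenvalues i * Complex.I)) := by
  set hG := gram_isHermitian f
  have hf := fun i ↦ (h i).memLp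
  have hYm : ∀ i, AEMeasurable (Y i) P := fun i ↦ by
    simpa using (Complex.continuous_re.comp_aestronglyMeasurable (h i).2.1).aemeasurable
  have hηm : AEMeasurable (fun ω i ↦ ∑ j, hG.eigenvectorBasis i j * Y j ω) P :=
    aemeasurable_pi_lambda _ fun i ↦ Finset.aemeasurable_fun_sum _ fun j _ ↦ (hYm j).const_mul _
  -- An orthonormal change of coordinates preserves the sum of squares, and the new coordinates are
  -- independent.
  have hrot : ∀ ω, ∑ i, Y i ω ^ 2 = ∑ i, (∑ j, hG.eigenvectorBasis i j * Y j ω) ^ 2 := fun ω ↦ by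
    have := hG.eigenvectorBasis.sum_sq_inner_right (WithLp.toLp 2 fun i ↦ Y i ω)
    rw [EuclideanSpace.real_norm_sq_eq] at this
    rw [← this]
    refine Finset.sum_congr rfl fun i _ ↦ ?_
    congr 1
    simp only [PiLp.inner_apply, RCLike.inner_apply, conj_trivial]
    exact Finset.sum_congr rfl fun j _ ↦ mul_comm _ _
  have e : ∀ ω, Complex.exp (s * ((∑ i, Y i ω ^ 2 : ℝ) : ℂ) * Complex.I) =
      (fun y : ι → ℝ ↦ ∏ i, Complex.exp (s * (y i : ℂ) ^ 2 * Complex.I))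
        (fun i ↦ ∑ j, hG.eigenvectorBasis i j * Y j ω) := fun ω ↦ by
    simp only [hrot, Complex.ofReal_sum, Finset.mul_sum, Finset.sum_mul, Complex.exp_sum,
      Complex.ofReal_pow]
  rw [integral_congr_ae (.of_forall e)]
  refine (integral_map (f := fun y : ι → ℝ ↦ ∏ i, Complex.exp (s * (y i : ℂ) ^ 2 * Complex.I))
    hηm (Continuous.aestronglyMeasurable (by fun_prop))).symm.trans ?_
  rw [map_eigenbasis_coordinates hW h,
    integral_fintype_prod_eq_prod (fun (i : ι) (y : ℝ) ↦ Complex.exp (s * (y : ℂ) ^ 2 * Complex.I)),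
    Complex.exp_sum]
  refine Finset.prod_congr rfl fun i _ ↦ ?_
  rw [integral_exp_sq_gaussianReal, Real.coe_toNNReal _ (gram_eigenvalues_nonneg hf i)]

end QuadraticForm

/-! ### Asymptotics of the characteristic function -/

/-- Second-order Taylor expansion of `log(1 + z)` at `z = -2ita`. The remainder is at most `(1/2) *
8|ta|³ * 2 / 3`, where `2` bounds `(1 - |z|)⁻¹`. -/
theorem norm_log_one_sub_le {a t : ℝ} (h : |2 * t * a| ≤ 1 / 2) :
    ‖-(1 / 2) * Complex.log (1 - 2 * t * a * Complex.I) - t * a * Complex.I + t ^ 2 * a ^ 2‖ ≤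
      4 * |t| ^ 3 * |a| ^ 3 := by
  let z : ℂ := -(2 * t * a * Complex.I)
  have hz : ‖z‖ = |2 * t * a| := by
    simp [z, abs_mul]
  have hT : Complex.logTaylor 3 z = z - z ^ 2 / 2 := by
    simp [Complex.logTaylor_succ, Complex.logTaylor_zero]
    ring
  have hle := Complex.norm_log_sub_logTaylor_le 2 (z := z) (by rw [hz]; linarith)
  have e : -(1 / 2) * Complex.log (1 - 2 * t * a * Complex.I) - t * a * Complex.I + t ^ 2 * a ^ 2 =
      -(1 / 2) * (Complex.log (1 + z) - Complex.logTaylor (2 + 1) z) := by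
    rw [hT]
    simp only [z, neg_sq, mul_pow, Complex.I_sq]
    ring_nf
  rw [e, norm_mul]
  have h2 : (1 - ‖z‖)⁻¹ ≤ 2 := by
    rw [hz]
    exact inv_le_of_inv_le₀ (by norm_num) (by linarith)
  have h3 : ‖z‖ ^ 3 = 8 * |t| ^ 3 * |a| ^ 3 := by
    rw [hz, abs_mul, abs_mul, abs_two]
    ring
  calc ‖(-(1 / 2) : ℂ)‖ * ‖Complex.log (1 + z) - Complex.logTaylor (2 + 1) z‖
      ≤ (1 / 2) * (‖z‖ ^ (2 + 1) * (1 - ‖z‖)⁻¹ / ((2 : ℕ) + 1)) := by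
        gcongr
        simp
    _ ≤ (1 / 2) * (‖z‖ ^ (2 + 1) * 2 / ((2 : ℕ) + 1)) := by gcongr
    _ ≤ _ := by
        norm_num [h3]
        have : 0 ≤ |t| ^ 3 * |a| ^ 3 := by positivity
        linarith

/-- The cubic remainders sum to at most a constant times `M n * ∑ a²`, which vanishes when the
largest eigenvalue does. -/
theorem tendsto_sum_log_one_sub {ι : ℕ → Type*} [∀ n, Fintype (ι n)] {a : ∀ n, ι n → ℝ}
    {M : ℕ → ℝ} {S : ℝ} (ha : ∀ n i, 0 ≤ a n i) (haM : ∀ n i, a n i ≤ M n)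
    (hM : Tendsto M atTop (𝓝 0)) (hS : Tendsto (fun n ↦ ∑ i, a n i ^ 2) atTop (𝓝 S)) (t : ℝ) :
    Tendsto (fun n ↦ ∑ i, (-(1 / 2) * Complex.log (1 - 2 * t * a n i * Complex.I) -
      t * a n i * Complex.I)) atTop (𝓝 (-(t ^ 2 * S : ℝ))) := by
  have h1 : Tendsto (fun n ↦ ((-(t ^ 2 * ∑ i, a n i ^ 2) : ℝ) : ℂ)) atTop
      (𝓝 ((-(t ^ 2 * S) : ℝ) : ℂ)) :=
    (Complex.continuous_ofReal.tendsto _).comp (hS.const_mul _).neg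
  rw [Complex.ofReal_neg] at h1
  refine h1.congr_dist ?_
  have h2 : Tendsto (fun n ↦ 4 * |t| ^ 3 * (M n * ∑ i, a n i ^ 2)) atTop (𝓝 0) := by
    simpa using (hM.mul hS).const_mul (4 * |t| ^ 3)
  have h3 : ∀ᶠ n in atTop, |2 * t| * M n ≤ 1 / 2 := by
    have : Tendsto (fun n ↦ |2 * t| * M n) atTop (𝓝 0) := by simpa using hM.const_mul |2 * t|
    exact (this.eventually_lt_const (by norm_num : (0 : ℝ) < 1 / 2)).mono fun n hn ↦ hn.le
  refine squeeze_zero' (.of_forall fun n ↦ dist_nonneg) ?_ h2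
  filter_upwards [h3] with n hn
  rw [dist_comm, dist_eq_norm]
  have e : ∑ i, (-(1 / 2) * Complex.log (1 - 2 * t * a n i * Complex.I) - t * a n i * Complex.I) -
      ((-(t ^ 2 * ∑ i, a n i ^ 2) : ℝ) : ℂ) =
      ∑ i, (-(1 / 2) * Complex.log (1 - 2 * t * a n i * Complex.I) - t * a n i * Complex.I +
        t ^ 2 * a n i ^ 2) := by
    rw [Finset.sum_add_distrib]
    push_cast
    rw [Finset.mul_sum, sub_neg_eq_add]
  rw [e, Finset.mul_sum, Finset.mul_sum]
  refine (norm_sum_le _ _).trans (Finset.sum_le_sum fun i _ ↦ ?_)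
  refine (norm_log_one_sub_le ?_).trans ?_
  · rw [abs_mul, abs_of_nonneg (ha n i)]
    exact (mul_le_mul_of_nonneg_left (haM n i) (abs_nonneg _)).trans hn
  · rw [abs_of_nonneg (ha n i)]
    gcongr
    calc a n i ^ 3 = a n i * a n i ^ 2 := by ring
      _ ≤ M n * a n i ^ 2 := by gcongr; exact haM n i

/-! ### Toeplitz sums -/

/-- Each of the two diagonals at distance `m + 1` has `N - 1 - m` entries; the last coefficient is
zero. -/
theorem sum_sum_dist (F : ℕ → ℝ) (N : ℕ) :
    ∑ i ∈ Finset.range N, ∑ j ∈ Finset.range N, F (Nat.dist i j) =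
      N * F 0 + 2 * ∑ m ∈ Finset.range N, ((N : ℝ) - 1 - m) * F (m + 1) := by
  induction N with
  | zero => simp
  | succ N ih =>
    have hrow : ∑ j ∈ Finset.range N, F (Nat.dist N j) = ∑ m ∈ Finset.range N, F (m + 1) := by
      rw [← Finset.sum_range_reflect]
      refine Finset.sum_congr rfl fun j hj ↦ ?_
      rw [Finset.mem_range] at hj
      rw [Nat.dist_eq_sub_of_le_right (by lia)]
      congr 1
      lia
    simp_rw [Finset.sum_range_succ, Finset.sum_add_distrib, Nat.dist_comm _ N, Nat.dist_self, ih,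
      hrow]
    push_cast
    have e : ∑ m ∈ Finset.range N, ((N : ℝ) + 1 - 1 - m) * F (m + 1) =
        ∑ m ∈ Finset.range N, ((N : ℝ) - 1 - m) * F (m + 1) + ∑ m ∈ Finset.range N, F (m + 1) := by
      rw [← Finset.sum_add_distrib]
      exact Finset.sum_congr rfl fun m _ ↦ by ring
    rw [e]
    ring

/-- The entries on either side of the diagonal are each bounded by the full series. -/
theorem sum_dist_le {B : ℕ → ℝ} (hB : ∀ m, 0 ≤ B m) (hs : Summable B) {i N : ℕ} (hi : i < N) :
    ∑ j ∈ Finset.range N, B (Nat.dist i j) ≤ 2 * ∑' m, B m := by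
  have hs' : Summable fun m ↦ B (m + 1) := (summable_nat_add_iff 1).2 hs
  rw [Finset.range_eq_Ico, ← Finset.sum_Ico_consecutive _ (Nat.zero_le i) hi.le,
    ← Finset.range_eq_Ico, two_mul]
  refine add_le_add ?_ ?_
  · calc ∑ j ∈ Finset.range i, B (Nat.dist i j) = ∑ m ∈ Finset.range i, B (m + 1) := by
          rw [← Finset.sum_range_reflect]
          refine Finset.sum_congr rfl fun j hj ↦ ?_
          rw [Finset.mem_range] at hj
          rw [Nat.dist_eq_sub_of_le_right (by lia)]
          congr 1
          lia
      _ ≤ ∑' m, B (m + 1) := hs'.sum_le_tsum _ fun m _ ↦ hB _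
      _ ≤ ∑' m, B m := by
          rw [hs.tsum_eq_zero_add]
          linarith [hB 0]
  · rw [Finset.sum_Ico_eq_sum_range]
    refine le_trans (le_of_eq ?_) (hs.sum_le_tsum (Finset.range (N - i)) fun m _ ↦ hB _)
    refine Finset.sum_congr rfl fun j _ ↦ ?_
    rw [Nat.dist_eq_sub_of_le (by lia), Nat.add_sub_cancel_left]

theorem tendsto_inv_mul_sum_dist_sq {s : ℕ → ℕ → ℝ} {R : ℕ → ℝ} {C : ℝ}
    (hs : ∀ m, Tendsto (s · m) atTop (𝓝 (R m))) (hb : ∀ n m, |s n m| ≤ C / ((m : ℝ) + 1) ^ 2) :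
    Tendsto (fun n : ℕ ↦ (n : ℝ)⁻¹ * ∑ i ∈ Finset.range (n - 1), ∑ j ∈ Finset.range (n - 1),
      s n (Nat.dist i j) ^ 2) atTop (𝓝 (R 0 ^ 2 + 2 * ∑' m, R (m + 1) ^ 2)) := by
  have hC : 0 ≤ C := by simpa using (abs_nonneg _).trans (hb 0 0)
  have hinv : Tendsto (fun n : ℕ ↦ (n : ℝ)⁻¹) atTop (𝓝 0) := tendsto_inv_atTop_nhds_zero_nat
  have hcoef : ∀ c : ℝ, Tendsto (fun n : ℕ ↦ ((n : ℝ) - c) * (n : ℝ)⁻¹) atTop (𝓝 1) := fun c ↦ by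
    have h1 : Tendsto (fun n : ℕ ↦ 1 - c * (n : ℝ)⁻¹) atTop (𝓝 1) := by
      simpa using (hinv.const_mul c).const_sub 1
    refine h1.congr' ?_
    filter_upwards [eventually_ge_atTop 1] with n hn
    have : (n : ℝ) ≠ 0 := by positivity
    field_simp
  -- The finite sum over diagonals, extended by zero to a series so that dominated convergence
  -- applies. The coefficient is `N - 1 - m` with `N = n - 1`, divided by `n`; it tends to 1.
  let f : ℕ → ℕ → ℝ := fun n m ↦
    if m < n - 1 then ((n : ℝ) - 2 - m) * (n : ℝ)⁻¹ * s n (m + 1) ^ 2 else 0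
  have hf : Tendsto (fun n ↦ ∑' m, f n m) atTop (𝓝 (∑' m, R (m + 1) ^ 2)) := by
    refine tendsto_tsum_of_dominated_convergence (bound := fun m ↦ C ^ 2 * (1 / ((m : ℝ) + 1) ^ 2))
      (summable_one_div_succ_sq.mul_left _) (fun m ↦ ?_) (.of_forall fun n m ↦ ?_)
    · have h1 := (hcoef (2 + m)).mul ((hs (m + 1)).pow 2)
      rw [one_mul] at h1
      refine h1.congr' ?_
      filter_upwards [eventually_gt_atTop (m + 1)] with n hn
      simp only [f]
      rw [if_pos (by lia)]
      ring
    · simp only [f]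
      split_ifs with hm
      · have hn : (m : ℝ) + 2 ≤ n := by
          have : m + 2 ≤ n := by lia
          exact_mod_cast this
        have hm0 : (0 : ℝ) ≤ m := by positivity
        have hn0 : (0 : ℝ) < n := by linarith
        have h1 : ((n : ℝ) - 2 - m) * (n : ℝ)⁻¹ ≤ 1 := by
          rw [← div_eq_mul_inv, div_le_one hn0]
          linarith
        have h0 : 0 ≤ ((n : ℝ) - 2 - m) * (n : ℝ)⁻¹ :=
          mul_nonneg (by linarith) (by positivity)
        have hsq : s n (m + 1) ^ 2 ≤ C ^ 2 * (1 / ((m : ℝ) + 1) ^ 2) := by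
          rw [← sq_abs]
          calc |s n (m + 1)| ^ 2 ≤ (C / (((m + 1 : ℕ) : ℝ) + 1) ^ 2) ^ 2 := by
                gcongr
                exact hb n (m + 1)
            _ ≤ (C / ((m : ℝ) + 1)) ^ 2 := by
                gcongr
                push_cast
                nlinarith
            _ = _ := by rw [div_pow, mul_one_div]
        rw [Real.norm_of_nonneg (mul_nonneg h0 (sq_nonneg _))]
        calc _ ≤ 1 * s n (m + 1) ^ 2 := by gcongr
          _ ≤ _ := by rw [one_mul]; exact hsq
      · rw [norm_zero]
        positivity
  have h0 : Tendsto (fun n : ℕ ↦ ((n : ℝ) - 1) * (n : ℝ)⁻¹ * s n 0 ^ 2 + 2 * ∑' m, f n m) atTop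
      (𝓝 (R 0 ^ 2 + 2 * ∑' m, R (m + 1) ^ 2)) := by
    simpa using ((hcoef 1).mul ((hs 0).pow 2)).add (hf.const_mul 2)
  refine h0.congr' ?_
  filter_upwards [eventually_ge_atTop 1] with n hn
  have hcast : ((n - 1 : ℕ) : ℝ) = (n : ℝ) - 1 := by
    rw [Nat.cast_sub hn, Nat.cast_one]
  have htsum : ∑' m, f n m = ∑ m ∈ Finset.range (n - 1), f n m :=
    tsum_eq_sum fun m hm ↦ if_neg (by simpa using hm)
  rw [sum_sum_dist fun m ↦ s n m ^ 2, htsum, hcast, mul_add, mul_left_comm _ (2 : ℝ)]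
  congr 1
  · ring
  · congr 1
    rw [Finset.mul_sum]
    refine Finset.sum_congr rfl fun m hm ↦ ?_
    simp only [f]
    rw [if_pos (Finset.mem_range.1 hm)]
    ring

/-! ### Polar coordinates -/

theorem integral_polar {g : EuclideanSpace ℝ (Fin 2) → ℝ} (hg : Integrable g) :
    ∫ ξ, g ξ = ∫ θ in Ioo (-Real.pi) Real.pi, ∫ r in Ioi (0 : ℝ),
      r * g !₂[r * Real.cos θ, r * Real.sin θ] := by
  have e₁ := (volume_preserving_finTwoArrow ℝ).symm
  have e₂ := PiLp.volume_preserving_toLp (Fin 2)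
  have hmp := e₂.comp e₁
  have hemb : MeasurableEmbedding
      (WithLp.toLp 2 ∘ (MeasurableEquiv.finTwoArrow (α := ℝ)).symm) :=
    (MeasurableEquiv.toLp 2 (Fin 2 → ℝ)).measurableEmbedding.comp
      (MeasurableEquiv.finTwoArrow (α := ℝ)).symm.measurableEmbedding
  let G : ℝ × ℝ → ℝ := fun p ↦ g !₂[p.1, p.2]
  have hG : Integrable G := (hmp.integrable_comp_emb hemb).2 hg
  have hint : ∫ ξ, g ξ = ∫ p, G p := (hmp.integral_comp hemb g).symm
  -- Exchanging radius and angle needs integrability in polar coordinates, which the change of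
  -- variables theorem transfers from the plane.
  have hGi : IntegrableOn (fun p : ℝ × ℝ ↦ p.1 * G (polarCoord.symm p))
      (Ioi (0 : ℝ) ×ˢ Ioo (-Real.pi) Real.pi) := by
    have h1 := (integrableOn_image_iff_integrableOn_abs_det_fderiv_smul volume
      (polarCoord.open_target.measurableSet)
      (fun p _ ↦ (hasFDerivAt_polarCoord_symm p).hasFDerivWithinAt) polarCoord.symm.injOn G).1
      hG.integrableOn
    refine h1.congr_fun (fun p hp ↦ ?_) polarCoord.open_target.measurableSet
    simp only [det_fderivPolarCoordSymm, smul_eq_mul, abs_of_pos (show 0 < p.1 from hp.1)]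
  rw [hint, ← integral_comp_polarCoord_symm]
  simp only [polarCoord_target, smul_eq_mul]
  rw [IntegrableOn, Measure.volume_eq_prod, ← Measure.prod_restrict] at hGi
  rw [Measure.volume_eq_prod, ← Measure.prod_restrict, integral_prod_symm _ hGi]
  rfl

/-! ### The kernel of the second difference -/

/-- The kernel of the second-order increment at `k / n` of the restriction to a segment. -/
noncomputable def diffKernel (H : EuclideanSpace ℝ (Fin 2) → ℝ) (L ε φ : ℝ) (n : ℕ) (k : ℝ)
    (ξ : EuclideanSpace ℝ (Fin 2)) : ℂ :=
  kernel H !₂[L * ((k + 1) / n + ε) * Real.cos φ, L * ((k + 1) / n + ε) * Real.sin φ] ξ +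
    kernel H !₂[L * ((k - 1) / n + ε) * Real.cos φ, L * ((k - 1) / n + ε) * Real.sin φ] ξ -
    2 * kernel H !₂[L * (k / n + ε) * Real.cos φ, L * (k / n + ε) * Real.sin φ] ξ

/-- The constants `-1` in the three kernels cancel and `e^(i(x+b)) + e^(i(x-b)) - 2e^(ix) = -2(1 -
cos b) e^(ix)`. Position and offset appear only in the phase, whence stationarity. -/
theorem diffKernel_eq (H : EuclideanSpace ℝ (Fin 2) → ℝ) (L ε φ : ℝ) (n : ℕ) (k : ℝ)
    (ξ : EuclideanSpace ℝ (Fin 2)) :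
    diffKernel H L ε φ n k ξ =
      Complex.exp (((L * (k / n + ε) * (Real.cos φ * ξ 0 + Real.sin φ * ξ 1) : ℝ) : ℂ) *
          Complex.I) *
        ((-(2 * (1 - Real.cos (L / n * (Real.cos φ * ξ 0 + Real.sin φ * ξ 1)))) /
          ‖ξ‖ ^ (H ξ + 1) : ℝ) : ℂ) := by
  have hin : ∀ x : ℝ, inner ℝ !₂[L * x * Real.cos φ, L * x * Real.sin φ] ξ =
      L * x * (Real.cos φ * ξ 0 + Real.sin φ * ξ 1) := fun x ↦ by
    simp only [PiLp.inner_apply, Fin.sum_univ_two, RCLike.inner_apply, conj_trivial,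
      Matrix.cons_val_zero, Matrix.cons_val_one]
    ring
  have h2 : ((2 : ℕ) : ℝ) / 2 = 1 := by norm_num
  simp only [diffKernel, kernel, hin, h2]
  set p := Real.cos φ * ξ 0 + Real.sin φ * ξ 1
  set N := ‖ξ‖ ^ (H ξ + 1)
  have ea : L * ((k + 1) / n + ε) * p = L * (k / n + ε) * p + L / n * p := by ring
  have eb : L * ((k - 1) / n + ε) * p = L * (k / n + ε) * p - L / n * p := by ring
  rw [ea, eb]
  set x := L * (k / n + ε) * p
  set b := L / n * p
  have hc : ((Real.cos b : ℝ) : ℂ) =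
      (Complex.exp (b * Complex.I) + Complex.exp (-b * Complex.I)) / 2 := by
    rw [Complex.ofReal_cos, Complex.cos]
  push_cast [-Complex.ofReal_cos]
  rw [hc, mul_add, mul_sub Complex.I, Complex.exp_add, sub_eq_add_neg (Complex.I * x),
    Complex.exp_add, mul_comm Complex.I (x : ℂ), mul_comm Complex.I (b : ℂ), neg_mul]
  ring

theorem diffKernel_mul_conj_re (H : EuclideanSpace ℝ (Fin 2) → ℝ) (L ε φ : ℝ) (n : ℕ) (j k : ℝ)
    (ξ : EuclideanSpace ℝ (Fin 2)) :
    (diffKernel H L ε φ n j ξ * conj (diffKernel H L ε φ n k ξ)).re =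
      Real.cos ((j - k) * (L / n * (Real.cos φ * ξ 0 + Real.sin φ * ξ 1))) *
        (2 * (1 - Real.cos (L / n * (Real.cos φ * ξ 0 + Real.sin φ * ξ 1))) /
          ‖ξ‖ ^ (H ξ + 1)) ^ 2 := by
  rw [diffKernel_eq, diffKernel_eq, map_mul, Complex.conj_ofReal, ← Complex.exp_conj, map_mul,
    Complex.conj_ofReal, Complex.conj_I]
  set p := Real.cos φ * ξ 0 + Real.sin φ * ξ 1
  set q : ℝ := -(2 * (1 - Real.cos (L / n * p))) / ‖ξ‖ ^ (H ξ + 1) with hq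
  have e : ∀ x y : ℝ, Complex.exp (x * Complex.I) * (q : ℂ) *
      (Complex.exp (y * -Complex.I) * (q : ℂ)) =
      Complex.exp (((x - y : ℝ) : ℂ) * Complex.I) * ((q ^ 2 : ℝ) : ℂ) := fun x y ↦ by
    have : ((x - y : ℝ) : ℂ) * Complex.I = x * Complex.I + y * -Complex.I := by push_cast; ring
    rw [this, Complex.exp_add]
    push_cast
    ring
  rw [e, Complex.re_mul_ofReal, Complex.exp_ofReal_mul_I_re, hq]
  ring_nf

/-! ### The angular density of the covariance -/

section Angular

variable {H : EuclideanSpace ℝ (Fin 2) → ℝ}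

theorem IsDirectionalHurstIndex.measurable_angular (hH : IsDirectionalHurstIndex H) :
    Measurable (angular H) :=
  hH.measurable.comp (by fun_prop)

theorem IsDirectionalHurstIndex.angular_mem_Icc (hH : IsDirectionalHurstIndex H) (θ : ℝ) :
    angular H θ ∈ Icc (lowerIndex H) (upperIndex H) :=
  hH.mem_Icc _

theorem IsDirectionalHurstIndex.angular_mem_Ioo (hH : IsDirectionalHurstIndex H) (θ : ℝ) :
    angular H θ ∈ Ioo (0 : ℝ) 1 :=
  ⟨hH.lowerIndex_pos.trans_le (hH.angular_mem_Icc θ).1,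
    (hH.angular_mem_Icc θ).2.trans_lt hH.upperIndex_lt_one⟩

theorem IsDirectionalHurstIndex.lowerIndex_mem_Ioo (hH : IsDirectionalHurstIndex H) :
    lowerIndex H ∈ Ioo (0 : ℝ) 1 :=
  ⟨hH.lowerIndex_pos, (hH.angular_mem_Icc 0).1.trans_lt (hH.angular_mem_Ioo 0).2⟩

theorem IsDirectionalHurstIndex.angular_periodic (hH : IsDirectionalHurstIndex H) :
    Function.Periodic (angular H) Real.pi := fun θ ↦ by
  have e : (!₂[Real.cos (θ + Real.pi), Real.sin (θ + Real.pi)] : EuclideanSpace ℝ (Fin 2)) =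
      (-1 : ℝ) • !₂[Real.cos θ, Real.sin θ] := by
    ext i
    fin_cases i <;> simp
  rw [angular, e, hH.homogeneous _ _ (by norm_num), angular]

theorem IsDirectionalHurstIndex.lam_periodic (hH : IsDirectionalHurstIndex H) (L φ : ℝ) :
    Function.Periodic (Lam H L φ) Real.pi := fun θ ↦ by
  have e : θ + Real.pi - φ = θ - φ + Real.pi := by ring
  rw [Lam, hH.angular_periodic θ, e, Real.cos_add_pi, abs_neg, Lam]

theorem IsDirectionalHurstIndex.measurable_constC (hH : IsDirectionalHurstIndex H) :
    (Measurable fun θ ↦ constC 1 (angular H θ) ^ 2) ∧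
      ∃ K, ∀ θ, constC 1 (angular H θ) ^ 2 ≤ K := by
  set a := lowerIndex H
  set b := upperIndex H
  have ha := hH.lowerIndex_pos
  have hb := hH.upperIndex_lt_one
  have hab : a ≤ b := (hH.angular_mem_Icc 0).1.trans (hH.angular_mem_Icc 0).2
  let F : ℝ → ℝ := fun h ↦ Real.pi / (h * Real.Gamma (2 * h) * Real.sin (h * Real.pi))
  have hF : ContinuousOn F (Icc a b) := by
    refine ContinuousOn.div continuousOn_const (ContinuousOn.mul (ContinuousOn.mul continuousOn_id
      fun h hh ↦ ?_) (by fun_prop)) fun h hh ↦ ?_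
    · have h0 : 0 < 2 * h := by linarith [hh.1]
      have h1 : ContinuousAt Real.Gamma (2 * h) :=
        (Real.differentiableAt_Gamma fun m hm ↦ by
          have : (0 : ℝ) ≤ m := m.cast_nonneg
          linarith).continuousAt
      exact (ContinuousAt.comp' (f := fun h : ℝ ↦ 2 * h) h1 (by fun_prop)).continuousWithinAt
    · have h0 : 0 < h := ha.trans_le hh.1
      have h3 : 0 < Real.sin (h * Real.pi) :=
        Real.sin_pos_of_pos_of_lt_pi (mul_pos h0 Real.pi_pos)
          (by nlinarith [hh.2, Real.pi_pos])
      have h4 : 0 < Real.Gamma (2 * h) := Real.Gamma_pos_of_pos (by linarith)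
      positivity
  have heq : ∀ θ, constC 1 (angular H θ) ^ 2 = F (angular H θ) := fun θ ↦
    constC_one_sq (hH.angular_mem_Ioo θ)
  constructor
  · have hc : Continuous (IccExtend hab ((Icc a b).domRestrict F)) :=
      (continuousOn_iff_continuous_domRestrict.1 hF).Icc_extend'
    have he : (fun θ ↦ constC 1 (angular H θ) ^ 2) =
        fun θ ↦ IccExtend hab ((Icc a b).domRestrict F) (angular H θ) := by
      ext θ
      rw [heq, IccExtend_of_mem _ _ (hH.angular_mem_Icc θ)]
      rfl
    rw [he]
    exact hc.measurable.comp hH.measurable_angular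
  · obtain ⟨K, hK⟩ := isCompact_Icc.exists_bound_of_continuousOn hF
    exact ⟨K, fun θ ↦ by rw [heq]; exact (le_abs_self _).trans (hK _ (hH.angular_mem_Icc θ))⟩

theorem IsDirectionalHurstIndex.measurable_lam (hH : IsDirectionalHurstIndex H) (L φ : ℝ) :
    Measurable (Lam H L φ) := by
  have h1 := hH.measurable_constC.1
  have h2 := hH.measurable_angular
  unfold Lam
  fun_prop

theorem lam_nonneg {L : ℝ} (hL : 0 < L) (φ θ : ℝ) : 0 ≤ Lam H L φ θ := by
  unfold Lam
  positivity

theorem IsDirectionalHurstIndex.exists_lam_le (hH : IsDirectionalHurstIndex H) {L : ℝ} (hL : 0 < L)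
    (φ : ℝ) : ∃ K, ∀ θ, Lam H L φ θ ≤ K := by
  obtain ⟨K, hK⟩ := hH.measurable_constC.2
  -- The base `1 + L` exceeds 1, so exponents below 2 are controlled whether or not `L < 1`.
  refine ⟨K / 8 * (1 + L) ^ 2 * 1, fun θ ↦ ?_⟩
  have h0 := hH.angular_mem_Ioo θ
  have hK0 : 0 ≤ K := (sq_nonneg _).trans (hK θ)
  unfold Lam
  gcongr
  · exact hK θ
  · calc L ^ (2 * angular H θ) ≤ (1 + L) ^ (2 * angular H θ) :=
          Real.rpow_le_rpow hL.le (by linarith) (by linarith [h0.1])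
      _ ≤ (1 + L) ^ (2 : ℝ) :=
          Real.rpow_le_rpow_of_exponent_le (by linarith) (by linarith [h0.2])
      _ = (1 + L) ^ 2 := Real.rpow_two _
  · exact Real.rpow_le_one (abs_nonneg _) (Real.abs_cos_le_one _) (by linarith [h0.1])

/-- The covariance at lag `x` of the second-order increments with step `1 / n`. -/
noncomputable def incCov (H : EuclideanSpace ℝ (Fin 2) → ℝ) (L φ : ℝ) (n : ℕ) (x : ℝ) : ℝ :=
  ∫ θ in (0 : ℝ)..(2 * Real.pi), 4 * Lam H L φ θ * (n : ℝ) ^ (-(2 * angular H θ)) *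
    fbmCov (angular H θ) x

/-- Along a ray `H` is constant and the Jacobian turns `r^(-2(H+1))` into `r^(-(2H+1))`, so the
radial integral is the one-dimensional formula with speed `(L/n) cos(θ - φ)`. -/
theorem IsDirectionalHurstIndex.integral_diffKernel (hH : IsDirectionalHurstIndex H) {L : ℝ}
    (hL : 0 < L) (ε φ : ℝ) (n : ℕ) (j k : ℝ)
    (hj : MemLp (diffKernel H L ε φ n j) 2 volume) (hk : MemLp (diffKernel H L ε φ n k) 2 volume) :
    ∫ ξ, (diffKernel H L ε φ n j ξ * conj (diffKernel H L ε φ n k ξ)).re =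
      incCov H L φ n (j - k) := by
  have hint : Integrable fun ξ ↦
      (diffKernel H L ε φ n j ξ * conj (diffKernel H L ε φ n k ξ)).re :=
    (hj.integrable_mul hk.star).re
  rw [integral_polar hint]
  have hper : Function.Periodic (fun θ ↦ 4 * Lam H L φ θ * (n : ℝ) ^ (-(2 * angular H θ)) *
      fbmCov (angular H θ) (j - k)) (2 * Real.pi) := by
    have h1 := (hH.lam_periodic L φ).nat_mul 2
    have h2 := hH.angular_periodic.nat_mul 2
    rw [Nat.cast_ofNat] at h1 h2
    intro θ
    simp only [h1 θ, h2 θ]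
  have hshift := hper.intervalIntegral_add_eq 0 (-Real.pi)
  rw [zero_add, show -Real.pi + 2 * Real.pi = Real.pi by ring] at hshift
  rw [incCov, hshift, intervalIntegral.integral_of_le (by linarith [Real.pi_pos]),
    integral_Ioc_eq_integral_Ioo]
  refine setIntegral_congr_fun measurableSet_Ioo fun θ _ ↦ ?_
  have hα := hH.angular_mem_Ioo θ
  have hpt : ∀ r ∈ Ioi (0 : ℝ), r * (diffKernel H L ε φ n j !₂[r * Real.cos θ, r * Real.sin θ] *
      conj (diffKernel H L ε φ n k !₂[r * Real.cos θ, r * Real.sin θ])).re =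
      Real.cos ((j - k) * (L / n * Real.cos (θ - φ) * r)) *
        (4 * (1 - Real.cos (L / n * Real.cos (θ - φ) * r)) ^ 2) *
        r ^ (-(2 * angular H θ + 1)) := fun r hr ↦ by
    have hr : 0 < r := hr
    have hvec : (!₂[r * Real.cos θ, r * Real.sin θ] : EuclideanSpace ℝ (Fin 2)) =
        r • !₂[Real.cos θ, Real.sin θ] := by
      ext i
      fin_cases i <;> simp
    have hnorm : ‖(!₂[r * Real.cos θ, r * Real.sin θ] : EuclideanSpace ℝ (Fin 2))‖ = r := by
      rw [EuclideanSpace.norm_eq, Fin.sum_univ_two]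
      simp only [Matrix.cons_val_zero, Matrix.cons_val_one, Real.norm_eq_abs, sq_abs]
      rw [mul_pow, mul_pow, ← mul_add, Real.cos_sq_add_sin_sq, mul_one, Real.sqrt_sq hr.le]
    have hHr : H !₂[r * Real.cos θ, r * Real.sin θ] = angular H θ := by
      rw [hvec, hH.homogeneous _ _ hr.ne', angular]
    have hp : L / n * (Real.cos φ * (r * Real.cos θ) + Real.sin φ * (r * Real.sin θ)) =
        L / n * Real.cos (θ - φ) * r := by
      rw [Real.cos_sub]
      ring
    rw [diffKernel_mul_conj_re, hnorm, hHr]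
    simp only [Matrix.cons_val_zero, Matrix.cons_val_one]
    rw [hp, Real.rpow_neg hr.le, div_pow, ← Real.rpow_natCast (r ^ _), ← Real.rpow_mul hr.le,
      show (angular H θ + 1) * ((2 : ℕ) : ℝ) = 2 * angular H θ + 1 + 1 by push_cast; ring,
      Real.rpow_add_one hr.ne']
    have := Real.rpow_pos_of_pos hr (2 * angular H θ + 1)
    field_simp
    ring
  rw [setIntegral_congr_fun measurableSet_Ioi hpt, integral_cos_mul_one_sub_cos_sq hα, Lam, abs_mul,
    abs_div, abs_of_pos hL, Nat.abs_cast, Real.mul_rpow (by positivity) (by positivity),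
    Real.div_rpow hL.le (by positivity), Real.rpow_neg (by positivity)]
  ring

end Angular

/-! ### Asymptotics of the normalized covariance -/

section Asymptotics

variable {H : EuclideanSpace ℝ (Fin 2) → ℝ}

theorem measurable_fbmCov (x : ℝ) : Measurable fun h ↦ fbmCov h x := by
  unfold fbmCov
  fun_prop

theorem fbmCov_neg (h x : ℝ) : fbmCov h (-x) = fbmCov h x := by
  simp only [fbmCov]
  rw [show -x + 2 = -(x - 2) by ring, show -x + 1 = -(x - 1) by ring,
    show -x - 1 = -(x + 1) by ring, show -x - 2 = -(x + 2) by ring]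
  simp only [abs_neg]
  ring

theorem incCov_sub_natCast (L φ : ℝ) (n i j : ℕ) :
    incCov H L φ n ((i : ℝ) - j) = incCov H L φ n (Nat.dist i j : ℕ) := by
  rcases le_total i j with h | h
  · rw [Nat.dist_eq_sub_of_le h, Nat.cast_sub h, ← neg_sub]
    simp only [incCov, fbmCov_neg]
  · rw [Nat.dist_eq_sub_of_le_right h, Nat.cast_sub h]

/-- The covariance of the increments, normalized by `n ^ (2h)` with `h = ess inf H`. -/
noncomputable def normCov (H : EuclideanSpace ℝ (Fin 2) → ℝ) (L φ : ℝ) (n m : ℕ) : ℝ :=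
  (n : ℝ) ^ (2 * lowerIndex H) * incCov H L φ n m

theorem normCov_eq (L φ : ℝ) {n : ℕ} (hn : 0 < n) (m : ℕ) :
    normCov H L φ n m = ∫ θ in (0 : ℝ)..(2 * Real.pi),
      4 * Lam H L φ θ * (n : ℝ) ^ (2 * lowerIndex H - 2 * angular H θ) *
        fbmCov (angular H θ) m := by
  rw [normCov, incCov, ← intervalIntegral.integral_const_mul]
  refine intervalIntegral.integral_congr fun θ _ ↦ ?_
  have hn' : (0 : ℝ) < n := by exact_mod_cast hn
  simp only [sub_eq_add_neg (2 * lowerIndex H), Real.rpow_add hn']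
  ring

/-- Homogeneity under `ξ ↦ -ξ` makes the integrand `π`-periodic, so the half circle counts twice. -/
theorem IsDirectionalHurstIndex.constJ_eq (hH : IsDirectionalHurstIndex H) {L : ℝ} (hL : 0 < L)
    (φ : ℝ) :
    constJ H L φ = ∫ θ in (0 : ℝ)..(2 * Real.pi),
      4 * {θ | angular H θ = lowerIndex H}.indicator (Lam H L φ) θ := by
  set g := {θ | angular H θ = lowerIndex H}.indicator (Lam H L φ)
  have hper : Function.Periodic g Real.pi := fun θ ↦ by
    simp only [g, indicator, Set.mem_ofPred_eq, hH.angular_periodic θ, hH.lam_periodic L φ θ]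
  obtain ⟨K, hK⟩ := hH.exists_lam_le hL φ
  have hset : MeasurableSet {θ | angular H θ = lowerIndex H} :=
    hH.measurable_angular (measurableSet_singleton _)
  have hgi : ∀ a b, IntervalIntegrable g volume a b := fun a b ↦ by
    refine (intervalIntegrable_const (c := K)).mono_fun
      ((hH.measurable_lam L φ).indicator hset).aestronglyMeasurable (.of_forall fun θ ↦ ?_)
    refine (norm_indicator_le_norm_self _ _).trans ?_
    rw [Real.norm_of_nonneg (lam_nonneg hL φ θ)]
    exact (hK θ).trans (le_abs_self K)
  have h2 := hper.intervalIntegral_add_eq_add 0 Real.pi hgi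
  rw [zero_add, ← two_mul] at h2
  rw [intervalIntegral.integral_const_mul, h2, constJ]
  ring

theorem abs_fbmCov_le_const {h : ℝ} (hh : h ∈ Ioo (0 : ℝ) 1) (m : ℕ) : |fbmCov h m| ≤ 1152 := by
  refine (abs_fbmCov_le hh m).trans (div_le_self (by norm_num) ?_)
  have : (0 : ℝ) ≤ m := by positivity
  nlinarith

/-- Since `H(θ)` is at least the lower index, the normalized power of `n` is at most 1, and the
bound on `fbmCov` uniform in the index survives the angular average. -/
theorem IsDirectionalHurstIndex.exists_abs_normCov_le (hH : IsDirectionalHurstIndex H) {L : ℝ}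
    (hL : 0 < L) (φ : ℝ) : ∃ C, ∀ n m : ℕ, |normCov H L φ n m| ≤ C / ((m : ℝ) + 1) ^ 2 := by
  obtain ⟨K, hK⟩ := hH.exists_lam_le hL φ
  have hK0 : 0 ≤ K := (lam_nonneg hL φ 0).trans (hK 0)
  refine ⟨4 * K * 1 * 1152 * |2 * Real.pi - 0|, fun n m ↦ ?_⟩
  rcases n.eq_zero_or_pos with rfl | hn
  · rw [normCov, Nat.cast_zero, Real.zero_rpow (by linarith [hH.lowerIndex_pos]), zero_mul,
      abs_zero]
    positivity
  rw [normCov_eq L φ hn]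
  have := intervalIntegral.norm_integral_le_of_norm_le_const (a := 0) (b := 2 * Real.pi)
    (f := fun θ ↦ 4 * Lam H L φ θ * (n : ℝ) ^ (2 * lowerIndex H - 2 * angular H θ) *
        fbmCov (angular H θ) m) (C := 4 * K * 1 * (1152 / ((m : ℝ) + 1) ^ 2)) fun θ _ ↦ by
    have h1 : (1 : ℝ) ≤ n := by exact_mod_cast hn
    have h2 := (hH.angular_mem_Icc θ).1
    have hp : (n : ℝ) ^ (2 * lowerIndex H - 2 * angular H θ) ≤ 1 :=
      Real.rpow_le_one_of_one_le_of_nonpos h1 (by linarith)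
    have h0 := lam_nonneg (H := H) hL φ θ
    rw [norm_mul, Real.norm_of_nonneg (by positivity)]
    gcongr
    · exact hK θ
    · exact abs_fbmCov_le (hH.angular_mem_Ioo θ) m
  refine this.trans (le_of_eq ?_)
  ring

theorem tendsto_natCast_rpow_zero {p : ℝ} (hp : p < 0) :
    Tendsto (fun n : ℕ ↦ (n : ℝ) ^ p) atTop (𝓝 0) := by
  have := (tendsto_rpow_neg_atTop (neg_pos.2 hp)).comp tendsto_natCast_atTop_atTop
  exact this.congr fun n ↦ by simp [Function.comp]

/-- Dominated convergence: the power of `n` equals 1 in minimal directions and tends to 0 in all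
others. -/
theorem IsDirectionalHurstIndex.tendsto_normCov (hH : IsDirectionalHurstIndex H) {L : ℝ}
    (hL : 0 < L) (φ : ℝ) (m : ℕ) :
    Tendsto (fun n ↦ normCov H L φ n m) atTop
      (𝓝 (constJ H L φ * fbmCov (lowerIndex H) m)) := by
  obtain ⟨K, hK⟩ := hH.exists_lam_le hL φ
  have hK0 : 0 ≤ K := (lam_nonneg hL φ 0).trans (hK 0)
  have hα := hH.measurable_angular
  have hΛ := hH.measurable_lam L φ
  rw [hH.constJ_eq hL, ← intervalIntegral.integral_mul_const]
  have key : Tendsto (fun n : ℕ ↦ ∫ θ in (0 : ℝ)..(2 * Real.pi),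
      4 * Lam H L φ θ * (n : ℝ) ^ (2 * lowerIndex H - 2 * angular H θ) *
        fbmCov (angular H θ) m) atTop (𝓝 (∫ θ in (0 : ℝ)..(2 * Real.pi),
      4 * {θ | angular H θ = lowerIndex H}.indicator (Lam H L φ) θ *
        fbmCov (lowerIndex H) m)) := by
    refine intervalIntegral.tendsto_integral_filter_of_dominated_convergence
      (fun _ ↦ 4 * K * 1 * 1152) (.of_forall fun n ↦ ?_) ?_ intervalIntegrable_const
      (.of_forall fun θ _ ↦ ?_)
    · have := (measurable_fbmCov m).comp hα
      exact Measurable.aestronglyMeasurable (by fun_prop)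
    · filter_upwards [eventually_ge_atTop 1] with n hn
      refine .of_forall fun θ _ ↦ ?_
      have h1 : (1 : ℝ) ≤ n := by exact_mod_cast hn
      have h2 := (hH.angular_mem_Icc θ).1
      have hp : (n : ℝ) ^ (2 * lowerIndex H - 2 * angular H θ) ≤ 1 :=
        Real.rpow_le_one_of_one_le_of_nonpos h1 (by linarith)
      have h0 := lam_nonneg (H := H) hL φ θ
      rw [norm_mul, Real.norm_of_nonneg (by positivity)]
      gcongr
      · exact hK θ
      · exact abs_fbmCov_le_const (hH.angular_mem_Ioo θ) m
    · by_cases hθ : angular H θ = lowerIndex H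
      · simp [hθ]
      · have hlt : lowerIndex H < angular H θ :=
          lt_of_le_of_ne (hH.angular_mem_Icc θ).1 (Ne.symm hθ)
        rw [indicator_of_notMem (by exact hθ)]
        simpa using ((tendsto_natCast_rpow_zero
          (by linarith : 2 * lowerIndex H - 2 * angular H θ < 0)).const_mul
          (4 * Lam H L φ θ)).mul_const (fbmCov (angular H θ) m)
  refine key.congr' ?_
  filter_upwards [eventually_gt_atTop 0] with n hn
  rw [normCov_eq L φ hn]

theorem IsDirectionalHurstIndex.tendsto_sqrt_mul_normCov_sub (hH : IsDirectionalHurstIndex H)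
    {L : ℝ} (hL : 0 < L) (φ : ℝ)
    (hgap : volume {θ : ℝ | θ ∈ Set.Ico 0 (2 * Real.pi) ∧ lowerIndex H < angular H θ ∧
      angular H θ ≤ lowerIndex H + 1 / 4} = 0) :
    Tendsto (fun n : ℕ ↦ √(n : ℝ) * (normCov H L φ n 0 - constJ H L φ * fbmCov (lowerIndex H) 0))
      atTop (𝓝 0) := by
  obtain ⟨K, hK⟩ := hH.exists_lam_le hL φ
  have hK0 : 0 ≤ K := (lam_nonneg hL φ 0).trans (hK 0)
  have hα := hH.measurable_angular
  have hΛ := hH.measurable_lam L φ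
  have hset : MeasurableSet {θ | angular H θ = lowerIndex H} :=
    hα (measurableSet_singleton _)
  have hfm := (measurable_fbmCov 0).comp hα
  have hgap' : ∀ᵐ θ : ℝ, θ ∈ uIoc 0 (2 * Real.pi) →
      angular H θ = lowerIndex H ∨ lowerIndex H + 1 / 4 < angular H θ := by
    -- The gap concerns `[0, 2π)` while the interval integral lives on `(0, 2π]`; the extra endpoint
    -- is null.
    have h1 : ∀ᵐ θ : ℝ, θ ≠ 2 * Real.pi := by simp [ae_iff]
    have h2 := measure_eq_zero_iff_ae_notMem.1 hgap
    filter_upwards [h1, h2] with θ hθ1 hθ2 hθ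
    rw [uIoc_of_le (by positivity)] at hθ
    by_contra! hne
    exact hθ2 ⟨⟨hθ.1.le, lt_of_le_of_ne hθ.2 hθ1⟩,
      lt_of_le_of_ne (hH.angular_mem_Icc θ).1 (Ne.symm hne.1), hne.2⟩
  -- `F` vanishes in minimal directions. Elsewhere, past the gap, the exponent `1/2 - 2(H(θ) - h)`
  -- is negative, so the power of `n` is bounded by 1 and tends to 0.
  let F : ℕ → ℝ → ℝ := fun n θ ↦ √(n : ℝ) *
    (4 * Lam H L φ θ * (n : ℝ) ^ (2 * lowerIndex H - 2 * angular H θ) * fbmCov (angular H θ) 0 -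
      4 * {θ | angular H θ = lowerIndex H}.indicator (Lam H L φ) θ * fbmCov (lowerIndex H) 0)
  have hF₀ : ∀ n θ, angular H θ = lowerIndex H → F n θ = 0 := fun n θ hθ ↦ by
    simp [F, hθ]
  have hF₁ : ∀ n : ℕ, 0 < n → ∀ θ, lowerIndex H + 1 / 4 < angular H θ →
      F n θ = 4 * Lam H L φ θ * fbmCov (angular H θ) 0 *
        (n : ℝ) ^ (1 / 2 + (2 * lowerIndex H - 2 * angular H θ)) := fun n hn θ hθ ↦ by
    have hn' : (0 : ℝ) < n := by exact_mod_cast hn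
    simp only [F]
    rw [indicator_of_notMem (by intro h; rw [Set.mem_ofPred_eq] at h; linarith),
      Real.sqrt_eq_rpow, Real.rpow_add hn']
    ring
  have key : Tendsto (fun n : ℕ ↦ ∫ θ in (0 : ℝ)..(2 * Real.pi), F n θ) atTop
      (𝓝 (∫ θ in (0 : ℝ)..(2 * Real.pi), (0 : ℝ))) := by
    refine intervalIntegral.tendsto_integral_filter_of_dominated_convergence
      (fun _ ↦ 4 * K * 1152 * 1) (.of_forall fun n ↦ ?_) ?_ intervalIntegrable_const ?_
    · have := hΛ.indicator hset
      have h' : Measurable fun θ ↦ fbmCov (angular H θ) 0 := hfm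
      exact Measurable.aestronglyMeasurable (by fun_prop)
    · filter_upwards [eventually_ge_atTop 1] with n hn
      filter_upwards [hgap'] with θ hθ hmem
      rcases hθ hmem with h | h
      · rw [hF₀ n θ h, norm_zero]
        positivity
      · rw [hF₁ n hn θ h, norm_mul, norm_mul,
          Real.norm_of_nonneg (mul_nonneg four_pos.le (lam_nonneg hL φ θ)),
          Real.norm_of_nonneg (Real.rpow_nonneg n.cast_nonneg _)]
        have h1 : (1 : ℝ) ≤ n := by exact_mod_cast hn
        have hp : (n : ℝ) ^ (1 / 2 + (2 * lowerIndex H - 2 * angular H θ)) ≤ 1 :=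
          Real.rpow_le_one_of_one_le_of_nonpos h1 (by linarith)
        have h0 := abs_fbmCov_le_const (hH.angular_mem_Ioo θ) 0
        rw [Nat.cast_zero] at h0
        gcongr
        · exact hK θ
        · exact h0
    · filter_upwards [hgap'] with θ hθ hmem
      rcases hθ hmem with h | h
      · simp_rw [hF₀ _ θ h]
        exact tendsto_const_nhds
      · have h1 := (tendsto_natCast_rpow_zero
          (by linarith : 1 / 2 + (2 * lowerIndex H - 2 * angular H θ) < 0)).const_mul
          (4 * Lam H L φ θ * fbmCov (angular H θ) 0)
        rw [mul_zero] at h1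
        refine h1.congr' ?_
        filter_upwards [eventually_gt_atTop 0] with n hn
        rw [hF₁ n hn θ h]
  rw [intervalIntegral.integral_zero] at key
  refine key.congr' ?_
  filter_upwards [eventually_gt_atTop 0] with n hn
  have hi₁ : IntervalIntegrable (fun θ ↦ 4 * Lam H L φ θ *
      (n : ℝ) ^ (2 * lowerIndex H - 2 * angular H θ) * fbmCov (angular H θ) 0) volume 0
      (2 * Real.pi) := by
    refine (intervalIntegrable_const (c := 4 * K * 1 * 1152)).mono_fun
      (Measurable.aestronglyMeasurable ?_) (.of_forall fun θ ↦ ?_)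
    · have h' : Measurable fun θ ↦ fbmCov (angular H θ) 0 := hfm
      fun_prop
    · have h1 : (1 : ℝ) ≤ n := by exact_mod_cast hn
      have h2 := (hH.angular_mem_Icc θ).1
      have hp : (n : ℝ) ^ (2 * lowerIndex H - 2 * angular H θ) ≤ 1 :=
        Real.rpow_le_one_of_one_le_of_nonpos h1 (by linarith)
      have h0 := lam_nonneg (H := H) hL φ θ
      have h3 := abs_fbmCov_le_const (hH.angular_mem_Ioo θ) 0
      rw [Nat.cast_zero] at h3
      refine le_trans (b := 4 * K * 1 * 1152) ?_ (le_abs_self _)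
      beta_reduce
      rw [norm_mul, Real.norm_of_nonneg (by positivity)]
      gcongr
      · exact hK θ
      · exact h3
  have hi₂ : IntervalIntegrable (fun θ ↦ 4 * {θ | angular H θ = lowerIndex H}.indicator
      (Lam H L φ) θ * fbmCov (lowerIndex H) 0) volume 0 (2 * Real.pi) := by
    refine IntervalIntegrable.mul_const (IntervalIntegrable.const_mul ?_ _) _
    refine (intervalIntegrable_const (c := K)).mono_fun
      (hΛ.indicator hset).aestronglyMeasurable (.of_forall fun θ ↦ ?_)
    refine (norm_indicator_le_norm_self _ _).trans ?_
    rw [Real.norm_of_nonneg (lam_nonneg hL φ θ)]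
    exact (hK θ).trans (le_abs_self K)
  have hs := normCov_eq (H := H) L φ hn 0
  rw [Nat.cast_zero] at hs
  rw [hs, hH.constJ_eq hL, ← intervalIntegral.integral_mul_const,
    ← intervalIntegral.integral_sub hi₁ hi₂, ← intervalIntegral.integral_const_mul]

end Asymptotics

/-! ### The central limit theorem -/

section CLT

variable {Ω : Type*} {H : EuclideanSpace ℝ (Fin 2) → ℝ}
  {W : FiniteBorel 2 → Ω → ℂ} {A : EuclideanSpace ℝ (Fin 2) → Ω → ℝ}

/-- The second-order increment at `k / n` of the restriction of `A` to a segment. -/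
noncomputable def segmentDiff (A : EuclideanSpace ℝ (Fin 2) → Ω → ℝ) (L ε φ : ℝ) (n : ℕ) (k : ℝ)
    (ω : Ω) : ℝ :=
  restrictToSegment A L ε φ ((k + 1) / n) ω + restrictToSegment A L ε φ ((k - 1) / n) ω -
    2 * restrictToSegment A L ε φ (k / n) ω

theorem quadVar_eq (A : EuclideanSpace ℝ (Fin 2) → Ω → ℝ) (L ε φ : ℝ) (n : ℕ) (ω : Ω) :
    quadVar (restrictToSegment A L ε φ) n ω =
      ∑ i : Fin (n - 1), segmentDiff A L ε φ n ((i : ℝ) + 1) ω ^ 2 := by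
  rw [quadVar, Finset.sum_Ico_eq_sum_range, Finset.sum_range]
  refine Finset.sum_congr rfl fun i _ ↦ ?_
  rw [segmentDiff]
  push_cast
  rw [add_comm (1 : ℝ)]

variable [MeasurableSpace Ω] {P : Measure Ω}

theorem IsAFBM.isStochasticIntegral_segmentDiff (hW : IsComplexGaussianMeasure W P)
    (hA : IsAFBM H W P A) (L ε φ : ℝ) (n : ℕ) (k : ℝ) :
    IsStochasticIntegral W P (diffKernel H L ε φ n k)
      fun ω ↦ (segmentDiff A L ε φ n k ω : ℂ) := by
  have h := ((hA !₂[L * ((k + 1) / n + ε) * Real.cos φ, L * ((k + 1) / n + ε) * Real.sin φ]).add hW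
    (hA !₂[L * ((k - 1) / n + ε) * Real.cos φ, L * ((k - 1) / n + ε) * Real.sin φ])).add hW
    ((hA !₂[L * (k / n + ε) * Real.cos φ, L * (k / n + ε) * Real.sin φ]).const_mul (-2))
  convert! h using 1
  · ext ξ
    rw [diffKernel]
    ring
  · ext ω
    simp only [segmentDiff, restrictToSegment]
    push_cast
    ring

/-- The kernels of the second-order increments with step `1 / n`. -/
noncomputable def diffKernels (H : EuclideanSpace ℝ (Fin 2) → ℝ) (L ε φ : ℝ) (n : ℕ)
    (i : Fin (n - 1)) : EuclideanSpace ℝ (Fin 2) → ℂ :=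
  diffKernel H L ε φ n ((i : ℝ) + 1)

theorem gram_diffKernels (hH : IsDirectionalHurstIndex H) (hW : IsComplexGaussianMeasure W P)
    (hA : IsAFBM H W P A) {L : ℝ} (hL : 0 < L) (ε φ : ℝ) (n : ℕ) (i j : Fin (n - 1)) :
    gram (diffKernels H L ε φ n) i j =
      (n : ℝ) ^ (-(2 * lowerIndex H)) * normCov H L φ n (Nat.dist i j) := by
  have hn : (0 : ℝ) < n := by
    have := i.2
    exact_mod_cast (by lia : 0 < n)
  have hmem := fun k ↦ (hA.isStochasticIntegral_segmentDiff hW L ε φ n k).memLp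
  simp only [gram, Matrix.of_apply, diffKernels]
  rw [hH.integral_diffKernel hL ε φ n _ _ (hmem _) (hmem _), add_sub_add_right_eq_sub,
    incCov_sub_natCast, normCov, ← mul_assoc, ← Real.rpow_add hn, neg_add_cancel, Real.rpow_zero,
    one_mul]

theorem sqrt_mul_rpow_mul_rpow {n : ℕ} (hn : 0 < n) (h : ℝ) :
    √(n : ℝ) * (n : ℝ) ^ (2 * h - 1) * (n : ℝ) ^ (-(2 * h)) = √(n : ℝ) * (n : ℝ)⁻¹ := by
  have hn' : (0 : ℝ) < n := by exact_mod_cast hn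
  rw [mul_assoc, ← Real.rpow_add hn', ← Real.rpow_neg_one]
  ring_nf

/-- The eigenvalues of the covariance matrix of the increments, in the normalization of the
central limit theorem. -/
noncomputable def normEigenvalue (H : EuclideanSpace ℝ (Fin 2) → ℝ) (L ε φ : ℝ) (n : ℕ)
    (i : Fin (n - 1)) : ℝ :=
  √(n : ℝ) * (n : ℝ) ^ (2 * lowerIndex H - 1) *
    (gram_isHermitian (diffKernels H L ε φ n)).eigenvalues i

theorem normEigenvalue_nonneg (hW : IsComplexGaussianMeasure W P) (hA : IsAFBM H W P A)
    (L ε φ : ℝ) (n : ℕ) (i : Fin (n - 1)) : 0 ≤ normEigenvalue H L ε φ n i :=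
  mul_nonneg (by positivity) (gram_eigenvalues_nonneg
    (fun _ ↦ (hA.isStochasticIntegral_segmentDiff hW L ε φ n _).memLp) i)

/-- The trace has `n - 1` equal entries, and `(n - 1)/√n = √n - 1/√n`; the second term is a
negligible correction to the mean. -/
theorem sum_normEigenvalue (hH : IsDirectionalHurstIndex H) (hW : IsComplexGaussianMeasure W P)
    (hA : IsAFBM H W P A) {L : ℝ} (hL : 0 < L) (ε φ : ℝ) {n : ℕ} (hn : 0 < n) :
    ∑ i, normEigenvalue H L ε φ n i =
      √(n : ℝ) * normCov H L φ n 0 - (√(n : ℝ))⁻¹ * normCov H L φ n 0 := by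
  have hn' : (0 : ℝ) < n := by exact_mod_cast hn
  have htr := (gram_isHermitian (diffKernels H L ε φ n)).trace_eq_sum_eigenvalues
  simp only [RCLike.ofReal_real_eq_id, id] at htr
  simp only [normEigenvalue]
  rw [← Finset.mul_sum, ← htr, Matrix.trace]
  simp only [Matrix.diag, gram_diffKernels hH hW hA hL, Nat.dist_self, Finset.sum_const,
    Finset.card_univ, Fintype.card_fin, nsmul_eq_mul]
  rw [Nat.cast_sub hn, Nat.cast_one]
  calc _ = (√(n : ℝ) * (n : ℝ) ^ (2 * lowerIndex H - 1) * (n : ℝ) ^ (-(2 * lowerIndex H))) *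
        ((n : ℝ) - 1) * normCov H L φ n 0 := by ring
    _ = _ := by
      have hs : √(n : ℝ) * √(n : ℝ) = n := Real.mul_self_sqrt hn'.le
      have hs0 : 0 < √(n : ℝ) := Real.sqrt_pos.2 hn'
      have hi : √(n : ℝ) * (n : ℝ)⁻¹ = (√(n : ℝ))⁻¹ := by
        nth_rewrite 2 [← hs]
        field_simp
      have hj : (√(n : ℝ))⁻¹ * n = √(n : ℝ) := by
        nth_rewrite 2 [← hs]
        field_simp
      rw [sqrt_mul_rpow_mul_rpow hn, hi, mul_sub, hj]
      ring

theorem sum_normEigenvalue_sq (hH : IsDirectionalHurstIndex H) (hW : IsComplexGaussianMeasure W P)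
    (hA : IsAFBM H W P A) {L : ℝ} (hL : 0 < L) (ε φ : ℝ) {n : ℕ} (hn : 0 < n) :
    ∑ i, normEigenvalue H L ε φ n i ^ 2 =
      (n : ℝ)⁻¹ * ∑ i ∈ Finset.range (n - 1), ∑ j ∈ Finset.range (n - 1),
        normCov H L φ n (Nat.dist i j) ^ 2 := by
  have hn' : (0 : ℝ) < n := by exact_mod_cast hn
  simp only [normEigenvalue, mul_pow _ ((gram_isHermitian _).eigenvalues _)]
  rw [← Finset.mul_sum, sum_eigenvalues_sq]
  simp only [gram_diffKernels hH hW hA hL, Finset.sum_range, mul_pow _ (normCov _ _ _ _ _)]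
  simp only [← Finset.mul_sum]
  rw [← mul_assoc, ← mul_pow, sqrt_mul_rpow_mul_rpow hn, mul_pow, Real.sq_sqrt hn'.le]
  congr 1
  field_simp

/-- Row sums of the normalized Toeplitz matrix are bounded uniformly in `n`, and the normalization
leaves a factor `n^(-1/2)`. -/
theorem normEigenvalue_le (hH : IsDirectionalHurstIndex H) (hW : IsComplexGaussianMeasure W P)
    (hA : IsAFBM H W P A) {L : ℝ} (hL : 0 < L) (ε φ : ℝ) {C : ℝ}
    (hC : ∀ n m : ℕ, |normCov H L φ n m| ≤ C / ((m : ℝ) + 1) ^ 2) (n : ℕ) (i : Fin (n - 1)) :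
    normEigenvalue H L ε φ n i ≤
      √(n : ℝ) * (n : ℝ)⁻¹ * (2 * ∑' m : ℕ, C / ((m : ℝ) + 1) ^ 2) := by
  have hn : 0 < n := by
    have := i.2
    lia
  have hC0 : 0 ≤ C := by simpa using (abs_nonneg _).trans (hC 0 0)
  have hs : Summable fun m : ℕ ↦ C / ((m : ℝ) + 1) ^ 2 := by
    simpa [div_eq_mul_inv] using summable_one_div_succ_sq.mul_left C
  rw [normEigenvalue, ← sqrt_mul_rpow_mul_rpow hn (lowerIndex H), mul_assoc _ _ (2 * _)]
  refine mul_le_mul_of_nonneg_left (eigenvalues_le_of_row_sum_le _ (fun i ↦ ?_) i) (by positivity)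
  simp only [gram_diffKernels hH hW hA hL, abs_mul, abs_of_nonneg
    (Real.rpow_nonneg (Nat.cast_nonneg n : (0 : ℝ) ≤ n) _)]
  rw [← Finset.mul_sum]
  refine mul_le_mul_of_nonneg_left ?_ (by positivity)
  calc ∑ j : Fin (n - 1), |normCov H L φ n (Nat.dist i j)|
      ≤ ∑ j : Fin (n - 1), C / ((Nat.dist i j : ℝ) + 1) ^ 2 :=
        Finset.sum_le_sum fun j _ ↦ hC n _
    _ = ∑ j ∈ Finset.range (n - 1), C / ((Nat.dist i j : ℝ) + 1) ^ 2 := by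
        rw [Finset.sum_range]
    _ ≤ _ := sum_dist_le (B := fun m : ℕ ↦ C / ((m : ℝ) + 1) ^ 2) (fun m ↦ by positivity) hs i.2

end CLT

end AFBM

/-! ### Convergence of the characteristic functions. -/

open AFBM in
/-- Central limit theorem for the second-order quadratic variation of the restriction `Z` of an
anisotropic fractional Brownian motion to a radial segment of the plane. -/
theorem proposition11 {Ω : Type*} [MeasurableSpace Ω] (P : Measure Ω) [IsProbabilityMeasure P]
    (H : EuclideanSpace ℝ (Fin 2) → ℝ) (hH : AFBM.IsDirectionalHurstIndex H)
    (W : AFBM.FiniteBorel 2 → Ω → ℂ) (hW : AFBM.IsComplexGaussianMeasure W P)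
    (A : EuclideanSpace ℝ (Fin 2) → Ω → ℝ) (hA : AFBM.IsAFBM H W P A)
    (L ε φ : ℝ) (hL : 0 < L) (hε : 0 ≤ ε) (hφ : φ ∈ Set.Ico 0 (2 * Real.pi))
    (hlass : 0 < volume {θ : ℝ | θ ∈ Set.Ico 0 (2 * Real.pi) ∧
      AFBM.angular H θ = AFBM.lowerIndex H})
    (hgap : volume {θ : ℝ | θ ∈ Set.Ico 0 (2 * Real.pi) ∧
      AFBM.lowerIndex H < AFBM.angular H θ ∧
      AFBM.angular H θ ≤ AFBM.lowerIndex H + 1 / 4} = 0) :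
    TendstoInDistribution
      (fun (n : ℕ) (ω : Ω) ↦
        √(n : ℝ) * ((n : ℝ) ^ (2 * AFBM.lowerIndex H - 1) *
            AFBM.quadVar (AFBM.restrictToSegment A L ε φ) n ω -
          (4 - 2 ^ (2 * AFBM.lowerIndex H)) * AFBM.constJ H L φ))
      atTop (id : ℝ → ℝ) (fun _ ↦ P)
      (gaussianReal 0
        (AFBM.constJ H L φ ^ 2 * AFBM.sigmaSqFBM (AFBM.lowerIndex H)).toNNReal) := by
  have hAm : ∀ u, AEMeasurable (A u) P := fun u ↦ by
    simpa using (Complex.continuous_re.comp_aestronglyMeasurable (hA u).2.1).aemeasurable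
  have hXm : ∀ n : ℕ, AEMeasurable (fun ω ↦ √(n : ℝ) * ((n : ℝ) ^ (2 * lowerIndex H - 1) *
      quadVar (restrictToSegment A L ε φ) n ω -
        (4 - 2 ^ (2 * lowerIndex H)) * constJ H L φ)) P := fun n ↦ by
    have hq : AEMeasurable (fun ω ↦ quadVar (restrictToSegment A L ε φ) n ω) P :=
      Finset.aemeasurable_fun_sum _ fun k _ ↦
        (((hAm _).add (hAm _)).sub ((hAm _).const_mul 2)).pow_const 2
    exact ((hq.const_mul _).sub_const _).const_mul _
  refine ⟨hXm, aemeasurable_id, ProbabilityMeasure.tendsto_iff_tendsto_charFun.2 fun t ↦ ?_⟩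
  simp only [ProbabilityMeasure.coe_mk, Measure.map_id, charFun_gaussianReal]
  have hh := hH.lowerIndex_mem_Ioo
  obtain ⟨C, hC⟩ := hH.exists_abs_normCov_le hL φ
  have hsqrt : Tendsto (fun n : ℕ ↦ (√(n : ℝ))⁻¹) atTop (𝓝 0) :=
    tendsto_inv_atTop_zero.comp (Real.tendsto_sqrt_atTop.comp tendsto_natCast_atTop_atTop)
  have hmax : Tendsto (fun n : ℕ ↦ √(n : ℝ) * (n : ℝ)⁻¹ *
      (2 * ∑' m : ℕ, C / ((m : ℝ) + 1) ^ 2)) atTop (𝓝 0) := by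
    have : Tendsto (fun n : ℕ ↦ √(n : ℝ) * (n : ℝ)⁻¹) atTop (𝓝 0) :=
      hsqrt.congr fun n ↦ by rw [← div_eq_mul_inv, Real.sqrt_div_self]
    simpa using this.mul_const (2 * ∑' m : ℕ, C / ((m : ℝ) + 1) ^ 2)
  have hsq := tendsto_inv_mul_sum_dist_sq (fun m ↦ hH.tendsto_normCov hL φ m) hC
  -- The limit is half the variance because `sigmaSqFBM` is twice the lag sum; the half matches the
  -- exponent `-t²σ²/2`.
  replace hsq : Tendsto (fun n ↦ ∑ i, normEigenvalue H L ε φ n i ^ 2) atTop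
      (𝓝 (constJ H L φ ^ 2 * sigmaSqFBM (lowerIndex H) / 2)) := by
    have e : constJ H L φ ^ 2 * sigmaSqFBM (lowerIndex H) / 2 =
        (constJ H L φ * fbmCov (lowerIndex H) (0 : ℕ)) ^ 2 +
          2 * ∑' m : ℕ, (constJ H L φ * fbmCov (lowerIndex H) (m + 1 : ℕ)) ^ 2 := by
      simp only [mul_pow, tsum_mul_left, sigmaSqFBM_eq hh, Nat.cast_zero, Nat.cast_add,
        Nat.cast_one]
      ring
    rw [e]
    refine hsq.congr' ?_
    filter_upwards [eventually_gt_atTop 0] with n hn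
    rw [sum_normEigenvalue_sq hH hW hA hL ε φ hn]
  have hlog := tendsto_sum_log_one_sub (normEigenvalue_nonneg hW hA L ε φ)
    (normEigenvalue_le hH hW hA hL ε φ hC) hmax hsq t
  -- The trace is the mean of the normalized variation, so this is the asymptotic bias.
  have hmean : Tendsto (fun n : ℕ ↦ ∑ i, normEigenvalue H L ε φ n i -
      √(n : ℝ) * ((4 - 2 ^ (2 * lowerIndex H)) * constJ H L φ)) atTop (𝓝 0) := by
    have h1 := hsqrt.mul (hH.tendsto_normCov hL φ 0)
    rw [zero_mul] at h1
    have h2 := (hH.tendsto_sqrt_mul_normCov_sub hL φ hgap).sub h1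
    rw [sub_zero] at h2
    refine h2.congr' ?_
    filter_upwards [eventually_gt_atTop 0] with n hn
    rw [sum_normEigenvalue hH hW hA hL ε φ hn, fbmCov_zero hh.1]
    ring
  have hexp : Tendsto (fun n : ℕ ↦ Complex.exp (t * ((∑ i, normEigenvalue H L ε φ n i -
      √(n : ℝ) * ((4 - 2 ^ (2 * lowerIndex H)) * constJ H L φ) : ℝ) : ℂ) * Complex.I +
      ∑ i, (-(1 / 2) * Complex.log (1 - 2 * t * normEigenvalue H L ε φ n i * Complex.I) -
        t * normEigenvalue H L ε φ n i * Complex.I))) atTop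
      (𝓝 (Complex.exp (t * ((0 : ℝ) : ℂ) * Complex.I +
        -(t ^ 2 * (constJ H L φ ^ 2 * sigmaSqFBM (lowerIndex H) / 2) : ℝ)))) :=
    (Complex.continuous_exp.tendsto _).comp
      (((((Complex.continuous_ofReal.tendsto _).comp hmean).const_mul _).mul_const _).add hlog)
  have hσ : 0 ≤ constJ H L φ ^ 2 * sigmaSqFBM (lowerIndex H) := by
    rw [sigmaSqFBM_eq hh]
    have : 0 ≤ ∑' m : ℕ, fbmCov (lowerIndex H) (m + 1) ^ 2 := tsum_nonneg fun _ ↦ sq_nonneg _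
    positivity
  have hlim : Complex.exp (t * ((0 : ℝ) : ℂ) * Complex.I +
        -(t ^ 2 * (constJ H L φ ^ 2 * sigmaSqFBM (lowerIndex H) / 2) : ℝ)) =
      Complex.exp (t * ((0 : ℝ) : ℂ) * Complex.I -
        (constJ H L φ ^ 2 * sigmaSqFBM (lowerIndex H)).toNNReal * t ^ 2 / 2) := by
    rw [Real.coe_toNNReal _ hσ]
    push_cast
    congr 1
    ring
  rw [← hlim]
  -- For each `n` the characteristic function equals this exponential exactly: the trace, added in
  -- the first term, is subtracted again within the sum of logarithms.
  refine hexp.congr fun n ↦ ?_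
  rw [charFun_apply_real, integral_map (hXm n) (Continuous.aestronglyMeasurable (by fun_prop))]
  have hint := integral_exp_sum_sq hW (f := diffKernels H L ε φ n)
    (Y := fun i ↦ segmentDiff A L ε φ n ((i : ℝ) + 1))
    (fun i ↦ hA.isStochasticIntegral_segmentDiff hW L ε φ n _)
    (t * (√(n : ℝ) * (n : ℝ) ^ (2 * lowerIndex H - 1)))
  have hpt : ∀ ω, Complex.exp (t * ((√(n : ℝ) * ((n : ℝ) ^ (2 * lowerIndex H - 1) *
      quadVar (restrictToSegment A L ε φ) n ω -
        (4 - 2 ^ (2 * lowerIndex H)) * constJ H L φ) : ℝ) : ℂ) * Complex.I) =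
      Complex.exp (-(t * ((√(n : ℝ) * ((4 - 2 ^ (2 * lowerIndex H)) * constJ H L φ) : ℝ) : ℂ) *
        Complex.I)) *
      Complex.exp (((t * (√(n : ℝ) * (n : ℝ) ^ (2 * lowerIndex H - 1)) : ℝ) : ℂ) *
        ((∑ i : Fin (n - 1), segmentDiff A L ε φ n ((i : ℝ) + 1) ω ^ 2 : ℝ) : ℂ) *
          Complex.I) := fun ω ↦ by
    rw [← Complex.exp_add, quadVar_eq]
    congr 1
    simp only [Complex.ofReal_mul, Complex.ofReal_sub]
    ring
  simp_rw [hpt]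
  rw [integral_const_mul, hint, ← Complex.exp_add]
  congr 1
  rw [Finset.sum_sub_distrib]
  have e₁ : ∑ i, (t : ℂ) * normEigenvalue H L ε φ n i * Complex.I =
      t * ((∑ i, normEigenvalue H L ε φ n i : ℝ) : ℂ) * Complex.I := by
    rw [Complex.ofReal_sum, Finset.mul_sum, Finset.sum_mul]
  have e₂ : ∀ i, (2 : ℂ) * ((t * (√(n : ℝ) * (n : ℝ) ^ (2 * lowerIndex H - 1)) : ℝ) : ℂ) *
      ((gram_isHermitian (diffKernels H L ε φ n)).eigenvalues i : ℝ) * Complex.I =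
      2 * t * normEigenvalue H L ε φ n i * Complex.I := fun i ↦ by
    rw [normEigenvalue]
    push_cast
    ring
  simp_rw [e₂]
  rw [e₁, Complex.ofReal_sub]
  ring
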